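/- Let $S$ be the Conway sphere, i.e. the four times punctured sphere obtained as the quotient of $\mathbb{R}^2-\mathbb{Z}^2$ by the group generated by the $\pi$-rotations around the points of $\mathbb{Z}^2$. For $s\in\mathbb{Q}\cup\{\infty\}$ let $\alpha_s$ be the (unoriented) simple loop in $S$ obtained as the projection of a line of slope $s$ in $\mathbb{R}^2-\mathbb{Z}^2$. It determines an element of $\pi_1(S)$ up to conjugation and inversion. For an integer $n\ge 2$ let $$\mathrm{Hecke}(0;n)=\pi_1(S)/\langle\langle \alpha_\infty,\ \alpha_0^{\,n}\rangle\rangle ,$$ a group isomorphic to $\langle a,b\mid (ab)^n\rangle$ with $a,b$ represented by loops around punctures of $S$, and let $I(0;n)=[1/n,1]$. A meridian of $\mathrm{Hecke}(0;n)$ is an element represented by a simple loop around one of the four punctures of $S$. A loop in $S$ is called peripheral if it represents the conjugacy class of a power of a meridian, and torsion if it represents the conjugacy class of a non-trivial element of finite order of $\mathrm{Hecke}(0;n)$. Theorem. Let $n\ge 2$ be an integer. Then the following hold. 1. For every rational $s\in I(0;n)\cup\{0\}$, the loop $\alpha_s$ does not represent the trivial element of $\mathrm{Hecke}(0;n)$.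 2. For distinct rational numbers $s,s'\in I(0;n)$, the loops $\alpha_s$ and $\alpha_{s'}$, with any choice of orientations, represent distinct conjugacy classes in $\mathrm{Hecke}(0;n)$. 3. There is no rational number $s\in I(0;n)$ for which $\alpha_s$ is peripheral in $\mathrm{Hecke}(0;n)$. 4. There is no rational number $s\in I(0;n)$ for which $\alpha_s$ is torsion in $\mathrm{Hecke}(0;n)$. -/

import Mathlib

noncomputable section

namespace ConwayHecke

/-- The integral lattice `ℤ²` in the plane. -/
def lattice : Set (ℝ × ℝ) := Set.range fun m : ℤ × ℤ => ((m.1 : ℝ), (m.2 : ℝ))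

/-- The punctured plane `ℝ² - ℤ²`. -/
abbrev PuncturedPlane : Type := {x : ℝ × ℝ // x ∉ lattice}

theorem rotation_not_mem (m : ℤ × ℤ) {x : ℝ × ℝ} (hx : x ∉ lattice) :
    (2 * (m.1 : ℝ) - x.1, 2 * (m.2 : ℝ) - x.2) ∉ lattice := by
  rintro ⟨k, hk⟩
  apply hx
  rw [Prod.ext_iff] at hk
  refine ⟨(2 * m.1 - k.1, 2 * m.2 - k.2), ?_⟩
  ext
  · have := hk.1
    simp only at this
    push_cast
    linarith
  · have := hk.2
    simp only at this
    push_cast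
    linarith

/-- The `π`-rotation `x ↦ 2m - x` of the punctured plane around the lattice point `m`. -/
def piRotation (m : ℤ × ℤ) : Equiv.Perm PuncturedPlane where
  toFun x := ⟨(2 * (m.1 : ℝ) - x.1.1, 2 * (m.2 : ℝ) - x.1.2), rotation_not_mem m x.2⟩
  invFun x := ⟨(2 * (m.1 : ℝ) - x.1.1, 2 * (m.2 : ℝ) - x.1.2), rotation_not_mem m x.2⟩
  left_inv x := by ext <;> simp
  right_inv x := by ext <;> simp

/-- The group generated by the `π`-rotations around the points of `ℤ²`. -/
def rotationGroup : Subgroup (Equiv.Perm PuncturedPlane) :=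
  Subgroup.closure (Set.range piRotation)

/-- The Conway sphere: the quotient of `ℝ² - ℤ²` by the group generated by the `π`-rotations
around the points of `ℤ²`, with the quotient topology. It is a four times punctured sphere. -/
abbrev ConwaySphere : Type := Quotient (MulAction.orbitRel rotationGroup PuncturedPlane)

/-- The projection of the punctured plane onto the Conway sphere. -/
def proj (x : PuncturedPlane) : ConwaySphere := Quotient.mk _ x

theorem continuous_proj : Continuous proj := continuous_quotient_mk'

theorem proj_smul (g : rotationGroup) (x : PuncturedPlane) : proj (g • x) = proj x :=
  Quotient.sound ⟨g, rfl⟩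

/-- Points of the plane that differ by the rotation around `m` have the same projection. -/
theorem proj_rotation (m : ℤ × ℤ) (x : PuncturedPlane) : proj (piRotation m x) = proj x :=
  proj_smul ⟨piRotation m, Subgroup.subset_closure ⟨m, rfl⟩⟩ x

/-- Points of the plane that differ by a translation in `2ℤ²` have the same projection. -/
theorem proj_translate (m : ℤ × ℤ) (x y : PuncturedPlane)
    (h₁ : y.1.1 = x.1.1 + 2 * m.1) (h₂ : y.1.2 = x.1.2 + 2 * m.2) : proj y = proj x := by
  have : y = piRotation m (piRotation 0 x) := by
    ext
    · simp [piRotation, h₁]; ring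
    · simp [piRotation, h₂]; ring
  rw [this, proj_rotation, proj_rotation]

instance : PathConnectedSpace PuncturedPlane := by
  have hc : lattice.Countable := Set.countable_range _
  have h : IsPathConnected latticeᶜ := hc.isPathConnected_compl_of_one_lt_rank (by
    simp [one_add_one_eq_two])
  exact isPathConnected_iff_pathConnectedSpace.mp h

instance : PathConnectedSpace ConwaySphere :=
  (Quotient.mk_surjective (s := MulAction.orbitRel rotationGroup PuncturedPlane)).pathConnectedSpace
    continuous_proj

/-- The point with parameter `t` on the line `{(x, y) | p y - q x = 1/2}` of slope `q / p`,
parametrized with velocity `(2p, 2q)`. -/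
def linePoint (p q : ℤ) (t : ℝ) : ℝ × ℝ :=
  (-(q : ℝ) / (2 * ((p : ℝ) ^ 2 + (q : ℝ) ^ 2)) + t * (2 * p),
    (p : ℝ) / (2 * ((p : ℝ) ^ 2 + (q : ℝ) ^ 2)) + t * (2 * q))

theorem linePoint_equation {p q : ℤ} (h : IsCoprime p q) (t : ℝ) :
    (p : ℝ) * (linePoint p q t).2 - q * (linePoint p q t).1 = 1 / 2 := by
  have hne : (p : ℝ) ^ 2 + (q : ℝ) ^ 2 ≠ 0 := by
    intro h0
    have hp : (p : ℝ) = 0 := by nlinarith [sq_nonneg (p : ℝ), sq_nonneg (q : ℝ)]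
    have hq : (q : ℝ) = 0 := by nlinarith [sq_nonneg (p : ℝ), sq_nonneg (q : ℝ)]
    obtain ⟨u, v, huv⟩ := h
    rw [Int.cast_eq_zero.mp hp, Int.cast_eq_zero.mp hq] at huv
    simp at huv
  simp only [linePoint]
  field_simp
  ring

/-- The line `{(x, y) | p y - q x = 1/2}` contains no lattice point. -/
theorem linePoint_not_mem {p q : ℤ} (h : IsCoprime p q) (t : ℝ) : linePoint p q t ∉ lattice := by
  rintro ⟨m, hm⟩
  have e := linePoint_equation h t
  rw [← hm] at e
  have e' : ((2 * (p * m.2 - q * m.1) : ℤ) : ℝ) = ((1 : ℤ) : ℝ) := by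
    push_cast
    linarith
  have := Int.cast_injective e'
  omega

theorem continuous_linePoint (p q : ℤ) : Continuous (linePoint p q) := by
  unfold linePoint
  fun_prop

/-- For coprime `p` and `q`, the simple loop in the Conway sphere that is the projection of a line
in `ℝ² - ℤ²` of slope `q / p`: the segment from a point `z` to `z + (2p, 2q)` is one period of the
projected line. -/
def lineLoop (p q : ℤ) (h : IsCoprime p q) :
    Path (proj ⟨linePoint p q 0, linePoint_not_mem h 0⟩)
      (proj ⟨linePoint p q 0, linePoint_not_mem h 0⟩) where
  toFun t := proj ⟨linePoint p q t, linePoint_not_mem h t⟩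
  continuous_toFun := continuous_proj.comp
    (((continuous_linePoint p q).comp continuous_subtype_val).subtype_mk _)
  source' := rfl
  target' := proj_translate (p, q) _ _ (by simp [linePoint]) (by simp [linePoint])

/-- The circle of radius `1/2` around the lattice point `m`. -/
def circlePoint (m : ℤ × ℤ) (t : ℝ) : ℝ × ℝ :=
  ((m.1 : ℝ) + Real.cos (Real.pi * t) / 2, (m.2 : ℝ) + Real.sin (Real.pi * t) / 2)

theorem circlePoint_not_mem (m : ℤ × ℤ) (t : ℝ) : circlePoint m t ∉ lattice := by
  rintro ⟨k, hk⟩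
  rw [Prod.ext_iff] at hk
  simp only [circlePoint] at hk
  have h := Real.cos_sq_add_sin_sq (Real.pi * t)
  have h1 : Real.cos (Real.pi * t) = 2 * ((k.1 : ℝ) - m.1) := by linarith [hk.1]
  have h2 : Real.sin (Real.pi * t) = 2 * ((k.2 : ℝ) - m.2) := by linarith [hk.2]
  rw [h1, h2] at h
  have e : ((4 * ((k.1 - m.1) ^ 2 + (k.2 - m.2) ^ 2) : ℤ) : ℝ) = ((1 : ℤ) : ℝ) := by
    push_cast
    linarith
  have := Int.cast_injective e
  omega

theorem continuous_circlePoint (m : ℤ × ℤ) : Continuous (circlePoint m) := by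
  unfold circlePoint
  fun_prop

/-- The simple loop in the Conway sphere around the puncture that is the image of the lattice
point `m`: the projection of a half circle around `m`, whose end points are exchanged by the
`π`-rotation around `m`. -/
def punctureLoop (m : ℤ × ℤ) :
    Path (proj ⟨circlePoint m 0, circlePoint_not_mem m 0⟩)
      (proj ⟨circlePoint m 0, circlePoint_not_mem m 0⟩) where
  toFun t := proj ⟨circlePoint m t, circlePoint_not_mem m t⟩
  continuous_toFun := continuous_proj.comp
    (((continuous_circlePoint m).comp continuous_subtype_val).subtype_mk _)
  source' := rfl
  target' := by
    rw [← proj_rotation m]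
    congr 1
    ext
    · simp [piRotation, circlePoint]; ring
    · simp [piRotation, circlePoint]; ring

/-- An element of `π₁(S, x₀)`, for `S` the Conway sphere, represented by a loop `γ` based at `y`,
after joining `y` to `x₀` by some path. Its conjugacy class is the free homotopy class of `γ`. -/
def ofLoop (x₀ : ConwaySphere) {y : ConwaySphere} (γ : Path y y) : FundamentalGroup ConwaySphere x₀ :=
  FundamentalGroup.fundamentalGroupMulEquivOfPath (PathConnectedSpace.somePath y x₀)
    (FundamentalGroup.fromPath (Path.Homotopic.Quotient.mk γ))

theorem isCoprime_den_num (s : ℚ) : IsCoprime (s.den : ℤ) s.num :=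
  (Int.isCoprime_iff_nat_coprime.mpr (by simpa using s.reduced)).symm

/-- The element of `π₁(S, x₀)` represented by the simple loop `α_s` of slope `s ∈ ℚ`. -/
def alpha (x₀ : ConwaySphere) (s : ℚ) : FundamentalGroup ConwaySphere x₀ :=
  ofLoop x₀ (lineLoop s.den s.num (isCoprime_den_num s))

/-- The element of `π₁(S, x₀)` represented by the simple loop `α_∞` of slope `∞`. -/
def alphaInfty (x₀ : ConwaySphere) : FundamentalGroup ConwaySphere x₀ :=
  ofLoop x₀ (lineLoop 0 1 isCoprime_one_right)

/-- The even Heckoid group `Hecke(0; n) = π₁(S, x₀) / ⟪α_∞, α_0 ^ n⟫`. -/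
abbrev Hecke (x₀ : ConwaySphere) (n : ℕ) : Type :=
  FundamentalGroup ConwaySphere x₀ ⧸ Subgroup.normalClosure {alphaInfty x₀, alpha x₀ 0 ^ n}

/-- The element of `Hecke(0; n)` represented by `α_s`. -/
def heckeAlpha (x₀ : ConwaySphere) (n : ℕ) (s : ℚ) : Hecke x₀ n :=
  QuotientGroup.mk (alpha x₀ s)

/-- The meridian of `Hecke(0; n)` represented by the loop around the image of `m ∈ ℤ²`. -/
def meridian (x₀ : ConwaySphere) (n : ℕ) (m : ℤ × ℤ) : Hecke x₀ n :=
  QuotientGroup.mk (ofLoop x₀ (punctureLoop m))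

/-- An element of `Hecke(0; n)` is peripheral if it is conjugate to a power of a meridian. -/
def IsPeripheral {x₀ : ConwaySphere} {n : ℕ} (g : Hecke x₀ n) : Prop :=
  ∃ (m : ℤ × ℤ) (k : ℤ), IsConj g (meridian x₀ n m ^ k)

/-- An element of `Hecke(0; n)` is torsion if it is non-trivial and of finite order. -/
def IsTorsionElement {x₀ : ConwaySphere} {n : ℕ} (g : Hecke x₀ n) : Prop :=
  g ≠ 1 ∧ IsOfFinOrder g

end ConwayHecke

end

/-!
The group `Hecke(0; n)` is `⟨a, b | (a b) ^ n⟩`, a free product `ℤ * ℤ/n` with free factors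
generated by `a` and `c = a b`. Only homomorphisms out of it are needed. They come from flat
bundles on the Conway sphere: cut it along the two arcs that are the images of the lines `x = 0`
and `x = 1`, and glue the trivial bundle by `a` and `b` along these arcs (`tangleCocycle`).
Holonomy is read off from the crossings of a path with the vertical lines `x ∈ ℤ`
(`continuous_liftCoord`, `hol_proj`), so for every pair `a`, `b` in a group it kills `α_∞`, sends
`α_0` to a conjugate of `(a b)⁻¹`, loops around punctures to conjugates of `a^{±1}` and `b^{±1}`,
and `α_{q/p}` to a conjugate of the inverse of the word `∏_{i < 2p} l_i ^ {ε_i}`, where `l_i` is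
alternately `a` and `b` and `ε_i = (-1) ^ ⌊i q / p⌋` (`exists_hom_of_pair`).

For `q ≤ p` this word splits into `2 q` blocks of letters of constant sign, and in terms of `a` and
`c` it equals `∏_{j < 2q} c ^ {± e_j} a ^ {± 1}`, where `e_j` is the number of letters `b ^ {±1}` in
the `j`-th block (`lineWord_eq_blockWord`). Send `a` to `diag (t, 1/t)` and `c` to a fixed elliptic
matrix of order `n`. As `t → ∞` the trace grows like `L t ^ {2q}`, where `L` is the product of the
moduli of the entries of the matrices `c ^ {± e_j}` between the dominating eigendirections of the
neighbouring powers of `a` (`tendsto_trace_blockWord`). All block lengths are `m` or `m + 1`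
if `m ≤ p / q ≤ m + 1`, and the logarithm of the factor contributed by a block is affine in its
length and in `e_j`. Hence `log L² / q` is a piecewise affine function of `p / q`
(`log_prod_blockEntry`), and it is strictly increasing on `[1, n]` if the elliptic matrix is chosen
suitably (`blockNorm_lt_succ`, `interp_lt`).

So the trace of `α_s` for `s ∈ [1/n, 1]` is unbounded, which excludes finite order, and its growth
determines first `q` and then `p`; as the determinants have modulus one, inversion does not change
the modulus of the trace. Powers of meridians are excluded by commutative quotients: if `p` is odd,
the exponent sums of `a` and `b` in the word are `±1`, and if `p` is even, they vanish.
-/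

noncomputable section

open Topology Bundle

namespace ConwayHecke

/-! ### Flat bundles glued from two charts, and their holonomy -/

/-- A locally constant `G`-valued cocycle on a cover of `X` by two open sets `U` and `V`: the
transition function `g` on `U ∩ V` from the chart over `U` to the chart over `V`. -/
structure TwoChartCocycle (X G : Type*) [TopologicalSpace X] where
  /-- The first chart domain. -/
  U : Set X
  /-- The second chart domain. -/
  V : Set X
  isOpen_U : IsOpen U
  isOpen_V : IsOpen V
  cover : ∀ x, x ∈ U ∨ x ∈ V
  /-- The transition function; its values outside `U ∩ V` are irrelevant. -/
  g : X → G
  locConst : ∀ x ∈ U ∩ V, ∀ᶠ y in 𝓝 x, g y = g x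

namespace TwoChartCocycle

variable {X G : Type*} [TopologicalSpace X] [Group G]

/-- The left translation that changes coordinates from chart `i` to chart `j` at `x`, where
`false` stands for `U` and `true` for `V`. -/
def change (c : TwoChartCocycle X G) : Bool → Bool → X → G
  | false, true, x => c.g x
  | true, false, x => (c.g x)⁻¹
  | _, _, _ => 1

theorem change_locConst (c : TwoChartCocycle X G) {i j : Bool} {x : X}
    (hx : x ∈ (bif i then c.V else c.U) ∩ (bif j then c.V else c.U)) :
    ∀ᶠ y in 𝓝 x, c.change i j y = c.change i j x := by
  rcases i with _ | _ <;> rcases j with _ | _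
  · exact Filter.Eventually.of_forall fun _ => rfl
  · exact c.locConst x hx
  · filter_upwards [c.locConst x hx.symm] with y hy
    simp [change, hy]
  · exact Filter.Eventually.of_forall fun _ => rfl

variable [TopologicalSpace G] [DiscreteTopology G]

open Classical in
/-- The principal `G`-bundle with discrete fibre `G` glued from two trivial bundles by the left
translations by `g`. Over `U` the preferred chart is the one over `U`. -/
def core (c : TwoChartCocycle X G) : FiberBundleCore Bool X G where
  baseSet i := bif i then c.V else c.U
  isOpen_baseSet i := by cases i; exacts [c.isOpen_U, c.isOpen_V]
  indexAt x := !decide (x ∈ c.U)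
  mem_baseSet_at x := by
    by_cases h : x ∈ c.U
    · simp [h]
    · simpa [h] using (c.cover x).resolve_left h
  coordChange i j x h := c.change i j x * h
  coordChange_self i x _ v := by cases i <;> simp [change]
  continuousOn_coordChange i j := by
    rintro ⟨x, v⟩ ⟨hx, -⟩
    apply ContinuousAt.continuousWithinAt
    have h : (fun p : X × G => c.change i j p.1 * p.2) =ᶠ[𝓝 (x, v)]
        fun p => c.change i j x * p.2 := by
      filter_upwards [(c.change_locConst hx).prod_inl_nhds v] with p hp
      rw [hp]
    exact ContinuousAt.congr ((continuous_of_discreteTopology (f := fun h : G =>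
      c.change i j x * h)).comp continuous_snd).continuousAt h.symm
  coordChange_comp i j k x _ v := by
    cases i <;> cases j <;> cases k <;> simp [change]

theorem indexAt_of_mem (c : TwoChartCocycle X G) {x : X} (h : x ∈ c.U) :
    c.core.indexAt x = false := by simp [core, h]

theorem indexAt_of_notMem (c : TwoChartCocycle X G) {x : X} (h : x ∉ c.U) :
    c.core.indexAt x = true := by simp [core, h]

theorem isCoveringMap (c : TwoChartCocycle X G) :
    IsCoveringMap (TotalSpace.proj : c.core.TotalSpace → X) :=
  FiberBundle.isCoveringMap (F := G) (E := c.core.Fiber)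

/-- A point of the bundle in the preferred chart. -/
def pt (c : TwoChartCocycle X G) (x : X) (h : G) : c.core.TotalSpace := ⟨x, h⟩

/-- The coordinate of a point of the bundle in the preferred chart. -/
def coord (c : TwoChartCocycle X G) (e : c.core.TotalSpace) : G := e.2

/-- Continuity of a map into the bundle is checked in any chart: its `G`-coordinate there has
to be locally constant. -/
theorem continuousAt_pt (c : TwoChartCocycle X G) {A : Type*} [TopologicalSpace A] {γ : A → X}
    {F : A → G} {a : A} (hγ : ContinuousAt γ a) (i : Bool) (hi : γ a ∈ c.core.baseSet i)
    (hF : ∀ᶠ a' in 𝓝 a, c.change (c.core.indexAt (γ a')) i (γ a') * F a' =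
      c.change (c.core.indexAt (γ a)) i (γ a) * F a) :
    ContinuousAt (fun a => c.pt (γ a) (F a)) a := by
  have hmem : γ ⁻¹' c.core.baseSet i ∈ 𝓝 a :=
    hγ.preimage_mem_nhds ((c.core.isOpen_baseSet i).mem_nhds hi)
  refine ((c.core.localTriv i).toOpenPartialHomeomorph.continuousAt_iff_continuousAt_comp_left
    ?_).2 ?_
  · exact hmem
  · refine hγ.prodMk ?_
    exact ContinuousAt.congr continuousAt_const (Filter.EventuallyEq.symm hF)

/-- Right translations are automorphisms of the bundle. -/
theorem continuous_mul_right (c : TwoChartCocycle X G) (h : G) :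
    Continuous fun e : c.core.TotalSpace => c.pt e.1 (c.coord e * h) := by
  refine continuous_iff_continuousAt.2 fun e => ?_
  refine c.continuousAt_pt (γ := fun e : c.core.TotalSpace => e.1) (F := fun e => c.coord e * h)
    (c.core.continuous_proj.continuousAt) (c.core.indexAt e.1) (c.core.mem_baseSet_at _) ?_
  have hc : ContinuousAt (fun e' => (c.core.localTriv (c.core.indexAt e.1) e').2) e :=
    continuous_snd.continuousAt.comp
      ((c.core.localTriv (c.core.indexAt e.1)).toOpenPartialHomeomorph.continuousAt
        (c.core.mem_baseSet_at e.1))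
  have hd := hc.eventually_mem
    ((isOpen_discrete {(c.core.localTriv (c.core.indexAt e.1) e).2}).mem_nhds rfl)
  filter_upwards [hd] with e' he'
  have he'' : c.change (c.core.indexAt e'.1) (c.core.indexAt e.1) e'.1 * c.coord e' =
    c.change (c.core.indexAt e.1) (c.core.indexAt e.1) e.1 * c.coord e := he'
  rw [← mul_assoc, he'', mul_assoc]

/-- The holonomy of a homotopy class of paths: parallel transport in the preferred charts. -/
def hol (c : TwoChartCocycle X G) {x y : X} (γ : Path.Homotopic.Quotient x y) : G :=
  c.coord (c.isCoveringMap.monodromy γ ⟨c.pt x 1, rfl⟩).1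

/-- Monodromy commutes with right translations, so it is a left translation in the charts. -/
theorem monodromy_eq (c : TwoChartCocycle X G) {x y : X} (γ : Path.Homotopic.Quotient x y)
    (h : G) : (c.isCoveringMap.monodromy γ ⟨c.pt x h, rfl⟩).1 = c.pt y (c.hol γ * h) := by
  obtain ⟨γ⟩ := γ
  set L := c.isCoveringMap.liftPath γ (c.pt x 1) γ.source with hL
  have h1 : (fun t => c.pt (L t).1 (c.coord (L t) * h)) =
      c.isCoveringMap.liftPath γ (c.pt x h) γ.source := by
    refine (c.isCoveringMap.eq_liftPath_iff _).2 ⟨(c.continuous_mul_right h).comp L.continuous,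
      c.isCoveringMap.liftPath_lifts γ (c.pt x 1) γ.source, ?_⟩
    have h0 : L 0 = c.pt x 1 := c.isCoveringMap.liftPath_zero γ (c.pt x 1) γ.source
    simp only [h0]
    simp [pt, coord]
  have h2 : (L 1).1 = y :=
    (congr_fun (c.isCoveringMap.liftPath_lifts γ (c.pt x 1) γ.source) 1).trans γ.target
  have h3 : c.isCoveringMap.liftPath γ (c.pt x h) γ.source 1 =
      c.pt (L 1).1 (c.coord (L 1) * h) := (congr_fun h1 1).symm
  change c.isCoveringMap.liftPath γ (c.pt x h) γ.source 1 = c.pt y (c.coord (L 1) * h)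
  rw [h3, h2]

/-- Holonomy reverses the order of concatenation, as does the multiplication of the fundamental
group. -/
theorem hol_trans (c : TwoChartCocycle X G) {x y z : X} (γ : Path.Homotopic.Quotient x y)
    (γ' : Path.Homotopic.Quotient y z) : c.hol (γ.trans γ') = c.hol γ' * c.hol γ := by
  have h : c.isCoveringMap.monodromy γ ⟨c.pt x 1, rfl⟩ = ⟨c.pt y (c.hol γ), rfl⟩ :=
    Subtype.ext (by rw [c.monodromy_eq, mul_one])
  rw [hol, c.isCoveringMap.monodromy_trans_apply, h, c.monodromy_eq]
  rfl

theorem hol_refl (c : TwoChartCocycle X G) (x : X) : c.hol (.refl x) = 1 := by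
  rw [hol, c.isCoveringMap.monodromy_refl]
  rfl

/-- The holonomy of a path is read off from any continuous lift. -/
theorem hol_mk (c : TwoChartCocycle X G) {x y : X} (γ : Path x y) (F : unitInterval → G)
    (hF : Continuous fun t => c.pt (γ t) (F t)) :
    c.hol (Path.Homotopic.Quotient.mk γ) = F 1 * (F 0)⁻¹ := by
  have h1 : (fun t => c.pt (γ t) (F t)) =
      c.isCoveringMap.liftPath γ (c.pt x (F 0)) γ.source := by
    refine (c.isCoveringMap.eq_liftPath_iff _).2 ⟨hF, rfl, ?_⟩
    simp
  have h2 := c.monodromy_eq (Path.Homotopic.Quotient.mk γ) (F 0)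
  change c.isCoveringMap.liftPath γ (c.pt x (F 0)) γ.source 1 = _ at h2
  rw [← congr_fun h1 1, γ.target] at h2
  have h3 : F 1 = c.hol (Path.Homotopic.Quotient.mk γ) * F 0 := congr_arg c.coord h2
  rw [h3, mul_inv_cancel_right]

/-- The holonomy representation of the fundamental group. -/
def holHom (c : TwoChartCocycle X G) (x : X) : FundamentalGroup X x →* G where
  toFun γ := c.hol (x := x) (y := x) γ
  map_one' := c.hol_refl x
  map_mul' γ γ' := c.hol_trans (x := x) (y := x) (z := x) γ' γ

end TwoChartCocycle

/-- The holonomy of a free loop is well defined up to conjugacy. -/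
theorem TwoChartCocycle.isConj_holHom_ofLoop {G : Type*} [Group G] [TopologicalSpace G]
    [DiscreteTopology G] (c : TwoChartCocycle ConwaySphere G) (x₀ : ConwaySphere)
    {y : ConwaySphere} (γ : Path y y) :
    IsConj (c.hol (Path.Homotopic.Quotient.mk γ)) (c.holHom x₀ (ofLoop x₀ γ)) := by
  let δ : Path.Homotopic.Quotient y x₀ :=
    Path.Homotopic.Quotient.mk (PathConnectedSpace.somePath y x₀)
  have h : c.holHom x₀ (ofLoop x₀ γ) =
      c.hol (δ.symm.trans ((Path.Homotopic.Quotient.mk γ).trans δ)) := by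
    change c.hol _ = c.hol _
    congr 1
  have h2 : c.hol δ * c.hol δ.symm = 1 := by
    rw [← c.hol_trans, Path.Homotopic.Quotient.symm_trans, c.hol_refl]
  rw [h, c.hol_trans, c.hol_trans, ← eq_inv_of_mul_eq_one_right h2 |>.symm, isConj_iff]
  exact ⟨c.hol δ, rfl⟩

/-! ### A flat bundle on the Conway sphere -/

section

/-- A function invariant under the generating rotations is constant on orbits. -/
theorem rotation_invariant {α : Type*} {f : PuncturedPlane → α}
    (hf : ∀ m x, f (piRotation m x) = f x) {x y : PuncturedPlane}
    (h : MulAction.orbitRel rotationGroup PuncturedPlane x y) : f x = f y := by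
  obtain ⟨⟨g, hg⟩, rfl⟩ := h
  change f (g y) = f y
  induction hg using Subgroup.closure_induction generalizing y with
  | mem g hg => obtain ⟨m, rfl⟩ := hg; exact hf m y
  | one => rfl
  | mul g h _ _ ihg ihh => rw [Equiv.Perm.mul_apply, ihg, ihh]
  | inv g _ ih => rw [← ih (y := g⁻¹ y), ← Equiv.Perm.mul_apply, mul_inv_cancel,
      Equiv.Perm.one_apply]

theorem cos_rotation (m : ℤ) (x : ℝ) :
    Real.cos (Real.pi * (2 * (m : ℝ) - x)) = Real.cos (Real.pi * x) := by
  rw [← Real.cos_int_mul_two_pi_sub (Real.pi * x) m]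
  ring_nf

theorem sin_rotation (m : ℤ) (x : ℝ) :
    Real.sin (Real.pi * (2 * (m : ℝ) - x)) = -Real.sin (Real.pi * x) := by
  rw [← Real.sin_int_mul_two_pi_sub (Real.pi * x) m]
  ring_nf

/-- The function `cos (π x)` on the Conway sphere. -/
def cosX : ConwaySphere → ℝ :=
  Quotient.lift (fun z : PuncturedPlane => Real.cos (Real.pi * z.1.1)) fun _ _ h =>
    rotation_invariant (f := fun z : PuncturedPlane => Real.cos (Real.pi * z.1.1))
      (fun m z => cos_rotation m.1 z.1.1) h

/-- The function `cos (π y)` on the Conway sphere. -/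
def cosY : ConwaySphere → ℝ :=
  Quotient.lift (fun z : PuncturedPlane => Real.cos (Real.pi * z.1.2)) fun _ _ h =>
    rotation_invariant (f := fun z : PuncturedPlane => Real.cos (Real.pi * z.1.2))
      (fun m z => cos_rotation m.2 z.1.2) h

/-- The function `sin (π x) sin (π y)` on the Conway sphere. -/
def sinXY : ConwaySphere → ℝ :=
  Quotient.lift (fun z : PuncturedPlane => Real.sin (Real.pi * z.1.1) * Real.sin (Real.pi * z.1.2))
    fun _ _ h => rotation_invariant
      (f := fun z : PuncturedPlane => Real.sin (Real.pi * z.1.1) * Real.sin (Real.pi * z.1.2))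
      (fun m z => by
        change Real.sin (Real.pi * (2 * (m.1 : ℝ) - z.1.1)) *
          Real.sin (Real.pi * (2 * (m.2 : ℝ) - z.1.2)) = _
        rw [sin_rotation, sin_rotation, neg_mul_neg]) h

theorem cosX_proj (z : PuncturedPlane) : cosX (proj z) = Real.cos (Real.pi * z.1.1) := rfl

theorem sinXY_proj (z : PuncturedPlane) :
    sinXY (proj z) = Real.sin (Real.pi * z.1.1) * Real.sin (Real.pi * z.1.2) := rfl

theorem continuous_cosX : Continuous cosX := by
  refine Continuous.quotient_lift (f := fun z : PuncturedPlane => _) ?_ _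
  fun_prop

theorem continuous_cosY : Continuous cosY := by
  refine Continuous.quotient_lift (f := fun z : PuncturedPlane => _) ?_ _
  fun_prop

theorem continuous_sinXY : Continuous sinXY := by
  refine Continuous.quotient_lift (f := fun z : PuncturedPlane => _) ?_ _
  fun_prop

theorem sinXY_sq (s : ConwaySphere) : sinXY s ^ 2 = (1 - cosX s ^ 2) * (1 - cosY s ^ 2) := by
  obtain ⟨z, rfl⟩ := Quotient.mk_surjective s
  change (Real.sin _ * Real.sin _) ^ 2 = (1 - Real.cos _ ^ 2) * (1 - Real.cos _ ^ 2)
  rw [mul_pow, Real.sin_sq, Real.sin_sq]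

theorem sin_pi_mul_eq_zero_iff {x : ℝ} : Real.sin (Real.pi * x) = 0 ↔ ∃ r : ℤ, x = r := by
  rw [Real.sin_eq_zero_iff]
  constructor
  · rintro ⟨r, hr⟩
    exact ⟨r, mul_left_cancel₀ Real.pi_ne_zero (by linarith)⟩
  · rintro ⟨r, rfl⟩
    exact ⟨r, mul_comm _ _⟩

theorem cos_sq_ne_one_iff {x : ℝ} : Real.cos (Real.pi * x) ^ 2 ≠ 1 ↔ ∀ r : ℤ, x ≠ r := by
  rw [← not_exists, ← sin_pi_mul_eq_zero_iff, not_iff_not, Real.cos_sq', sub_eq_self,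
    sq_eq_zero_iff]

theorem proj_mem_cover (z : PuncturedPlane) :
    Real.cos (Real.pi * z.1.1) ^ 2 ≠ 1 ∨
      (Real.cos (Real.pi * z.1.2) ^ 2 ≠ 1 ∧ Real.cos (Real.pi * z.1.1) ≠ 0) := by
  by_cases h : Real.cos (Real.pi * z.1.1) ^ 2 = 1
  · refine Or.inr ⟨?_, fun h0 => by rw [h0] at h; norm_num at h⟩
    rw [cos_sq_ne_one_iff]
    intro k hk
    have h' := mt cos_sq_ne_one_iff.2 (not_not.2 h)
    push Not at h'
    obtain ⟨m, hm⟩ := h'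
    exact z.2 ⟨(m, k), Prod.ext hm.symm hk.symm⟩
  · exact Or.inl h

variable {G : Type*} [Group G]

/-- The flat bundle on the Conway sphere that is trivial away from the two vertical arcs joining
punctures, the images of the lines `x = 0` and `x = 1`, and whose holonomy across these arcs is
given by `a` and `b`. -/
def tangleCocycle (a b : G) : TwoChartCocycle ConwaySphere G where
  U := {s | cosX s ^ 2 ≠ 1}
  V := {s | cosY s ^ 2 ≠ 1 ∧ cosX s ≠ 0}
  isOpen_U := by
    have h := continuous_cosX
    exact isOpen_ne_fun (f := fun s => cosX s ^ 2) (by fun_prop) continuous_const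
  isOpen_V := by
    have h := continuous_cosX
    have h' := continuous_cosY
    exact (isOpen_ne_fun (f := fun s => cosY s ^ 2) (g := fun _ => 1) (by fun_prop)
      continuous_const).inter (isOpen_ne_fun (f := cosX) (g := fun _ => 0) h continuous_const)
  cover s := by
    obtain ⟨z, rfl⟩ := Quotient.mk_surjective s
    exact proj_mem_cover z
  g s := if 0 < sinXY s then 1 else if 0 < cosX s then a⁻¹ else b
  locConst s := by
    rintro ⟨h1, h2, h3⟩
    have h4 : sinXY s ≠ 0 := by
      intro h0
      have h := sinXY_sq s
      rw [h0, zero_pow two_ne_zero, eq_comm, mul_eq_zero, sub_eq_zero, sub_eq_zero] at h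
      rcases h with h | h
      exacts [h1 h.symm, h2 h.symm]
    have e1 : ∀ᶠ s' in 𝓝 s, (0 < sinXY s' ↔ 0 < sinXY s) := by
      rcases h4.lt_or_gt with h | h
      · filter_upwards [continuous_sinXY.continuousAt.eventually_lt_const h] with s' hs'
        exact ⟨fun h' => absurd h' hs'.not_gt, fun h' => absurd h' h.not_gt⟩
      · filter_upwards [continuous_sinXY.continuousAt.eventually_const_lt h] with s' hs'
        exact ⟨fun _ => h, fun _ => hs'⟩
    have e2 : ∀ᶠ s' in 𝓝 s, (0 < cosX s' ↔ 0 < cosX s) := by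
      rcases h3.lt_or_gt with h | h
      · filter_upwards [continuous_cosX.continuousAt.eventually_lt_const h] with s' hs'
        exact ⟨fun h' => absurd h' hs'.not_gt, fun h' => absurd h' h.not_gt⟩
      · filter_upwards [continuous_cosX.continuousAt.eventually_const_lt h] with s' hs'
        exact ⟨fun _ => h, fun _ => hs'⟩
    filter_upwards [e1, e2] with s' h h'
    simp only [h, h']

/-- The generator attached to the vertical line `x = r`. -/
def letter (a b : G) (r : ℤ) : G := if Even r then a else b

open Classical in
/-- The coordinate, in the preferred charts, of the lift of a path at the point `(x, y)`, if `W r`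
is its coordinate in the strip `r < x < r + 1`. -/
def liftCoord {G : Type*} (W : ℤ → G) (x y : ℝ) : G :=
  if x = ⌊x⌋ then
    if 0 < Real.cos (Real.pi * x) * Real.sin (Real.pi * y) then W ⌊x⌋ else W (⌊x⌋ - 1)
  else W ⌊x⌋

theorem liftCoord_of_mem {G : Type*} {W : ℤ → G} {x y : ℝ} {r : ℤ} (h1 : (r : ℝ) < x)
    (h2 : x < r + 1) : liftCoord W x y = W r := by
  have h : ⌊x⌋ = r := Int.floor_eq_iff.2 ⟨h1.le, h2⟩
  rw [liftCoord, h, if_neg h1.ne']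

theorem mem_tangleCocycle_U (a b : G) (z : PuncturedPlane) :
    proj z ∈ (tangleCocycle a b).U ↔ ∀ r : ℤ, z.1.1 ≠ r := cos_sq_ne_one_iff

variable [TopologicalSpace G] [DiscreteTopology G]

/-- A path in the punctured plane lifts to the flat bundle as soon as the values on consecutive
strips are related by the generators whenever the path crosses a vertical line. -/
theorem continuous_liftCoord (a b : G) {A : Type*} [TopologicalSpace A] {z : A → PuncturedPlane}
    (hz : Continuous z) (W : ℤ → G)
    (hpos : ∀ t (r : ℤ), (z t).1.1 = r → 0 < Real.sin (Real.pi * (z t).1.2) →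
      W r = (letter a b r)⁻¹ * W (r - 1))
    (hneg : ∀ t (r : ℤ), (z t).1.1 = r → Real.sin (Real.pi * (z t).1.2) < 0 →
      W r = letter a b r * W (r - 1)) :
    Continuous fun t => (tangleCocycle a b).pt (proj (z t)) (liftCoord W (z t).1.1 (z t).1.2) := by
  have hx : Continuous fun t => (z t).1.1 := by fun_prop
  have hy : Continuous fun t => Real.sin (Real.pi * (z t).1.2) := by fun_prop
  refine continuous_iff_continuousAt.2 fun t => ?_
  by_cases ht : ∀ r : ℤ, (z t).1.1 ≠ r
  -- Inside an open strip the coordinate is constant in the chart over `U`.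
  · refine (tangleCocycle a b).continuousAt_pt (continuous_proj.comp hz).continuousAt false
      ((mem_tangleCocycle_U a b _).2 ht) ?_
    have hlt : (⌊(z t).1.1⌋ : ℝ) < (z t).1.1 := (Int.floor_le _).lt_of_ne (ht _).symm
    filter_upwards [hx.continuousAt.eventually_const_lt hlt,
      hx.continuousAt.eventually_lt_const (Int.lt_floor_add_one (z t).1.1)] with t' h1 h2
    have ht' : ∀ r : ℤ, (z t').1.1 ≠ r := by
      intro r hr
      rw [hr] at h1 h2
      have h1' : ⌊(z t).1.1⌋ < r := by exact_mod_cast h1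
      have h2' : r < ⌊(z t).1.1⌋ + 1 := by exact_mod_cast h2
      omega
    rw [(tangleCocycle a b).indexAt_of_mem ((mem_tangleCocycle_U a b _).2 ht'),
      (tangleCocycle a b).indexAt_of_mem ((mem_tangleCocycle_U a b _).2 ht), liftCoord_of_mem h1 h2,
      liftCoord_of_mem hlt (Int.lt_floor_add_one _)]
    rfl
  · push Not at ht
    obtain ⟨r, hr⟩ := ht
    -- Near a crossing of `x = r` the values on both sides agree in the chart over `V`.
    have hU : proj (z t) ∉ (tangleCocycle a b).U := fun h => (mem_tangleCocycle_U a b _).1 h r hr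
    have hV := ((tangleCocycle a b).cover (proj (z t))).resolve_left hU
    refine (tangleCocycle a b).continuousAt_pt (continuous_proj.comp hz).continuousAt true hV ?_
    have hsin : Real.sin (Real.pi * (z t).1.2) ≠ 0 := by
      rw [Ne, sin_pi_mul_eq_zero_iff]
      rintro ⟨k, hk⟩
      exact (z t).2 ⟨(r, k), Prod.ext hr.symm hk.symm⟩
    have esign : ∀ᶠ t' in 𝓝 t, 0 < Real.sin (Real.pi * (z t').1.2) *
        Real.sin (Real.pi * (z t).1.2) :=
      (hy.mul continuous_const).continuousAt.eventually_const_lt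
        (mul_self_pos.2 hsin)
    have hr1 : (r : ℝ) - 1 / 2 < (z t).1.1 := by rw [hr]; linarith
    have hr2 : (z t).1.1 < r + 1 / 2 := by rw [hr]; linarith
    filter_upwards [hx.continuousAt.eventually_const_lt hr1,
      hx.continuousAt.eventually_lt_const hr2, esign] with t' h1 h2 hs
    rw [(tangleCocycle a b).indexAt_of_notMem hU]
    have hcos : Real.cos (Real.pi * (r : ℝ)) = if Even r then 1 else -1 := by
      rw [mul_comm, Real.cos_int_mul_pi]
      split_ifs with he
      · exact he.neg_one_zpow
      · exact (Int.not_even_iff_odd.1 he).neg_one_zpow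
    have ht0 : liftCoord W (z t).1.1 (z t).1.2 =
        if 0 < Real.cos (Real.pi * (r : ℝ)) * Real.sin (Real.pi * (z t).1.2) then W r
        else W (r - 1) := by
      rw [liftCoord, hr, Int.floor_intCast, if_pos rfl]
    have hc1 : (tangleCocycle a b).change true true (proj (z t)) = 1 := rfl
    rw [hc1, one_mul, ht0]
    by_cases hxr : (z t').1.1 = r
    · have hU' : proj (z t') ∉ (tangleCocycle a b).U := fun h =>
        (mem_tangleCocycle_U a b _).1 h r hxr
      rw [(tangleCocycle a b).indexAt_of_notMem hU']
      have hc2 : (tangleCocycle a b).change true true (proj (z t')) = 1 := rfl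
      rw [hc2, one_mul, liftCoord, hxr, Int.floor_intCast, if_pos rfl]
      have : 0 < Real.cos (Real.pi * (r : ℝ)) * Real.sin (Real.pi * (z t').1.2) ↔
          0 < Real.cos (Real.pi * (r : ℝ)) * Real.sin (Real.pi * (z t).1.2) := by
        rw [hcos]
        rcases lt_or_gt_of_ne hsin with h | h
        · have h' := neg_of_mul_pos_left hs h.le
          split_ifs <;> constructor <;> intro <;> linarith
        · have h' := pos_of_mul_pos_left hs h.le
          split_ifs <;> constructor <;> intro <;> linarith
      simp only [this]
    · have hU' : proj (z t') ∈ (tangleCocycle a b).U := by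
        rw [mem_tangleCocycle_U]
        intro k hk
        rw [hk] at h1 h2 hxr
        have h1' : ((2 * r - 1 : ℤ) : ℝ) < ((2 * k : ℤ) : ℝ) := by push_cast; linarith
        have h2' : ((2 * k : ℤ) : ℝ) < ((2 * r + 1 : ℤ) : ℝ) := by push_cast; linarith
        have h1'' := Int.cast_lt.1 h1'
        have h2'' := Int.cast_lt.1 h2'
        apply hxr
        have : k = r := by omega
        rw [this]
      rw [(tangleCocycle a b).indexAt_of_mem hU']
      change (if 0 < sinXY (proj (z t')) then 1 else
        if 0 < cosX (proj (z t')) then a⁻¹ else b) * _ = _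
      rw [sinXY_proj, cosX_proj]
      have hd : Real.pi * (z t').1.1 = Real.pi * ((z t').1.1 - r) + r * Real.pi := by ring
      have hsinx : Real.sin (Real.pi * (z t').1.1) =
          Real.cos (Real.pi * (r : ℝ)) * Real.sin (Real.pi * ((z t').1.1 - r)) := by
        rw [hd, Real.sin_add_int_mul_pi, mul_comm Real.pi (r : ℝ), Real.cos_int_mul_pi]
      have hcosx : Real.cos (Real.pi * (z t').1.1) =
          Real.cos (Real.pi * (r : ℝ)) * Real.cos (Real.pi * ((z t').1.1 - r)) := by
        rw [hd, Real.cos_add_int_mul_pi, mul_comm Real.pi (r : ℝ), Real.cos_int_mul_pi]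
      have hcpos : 0 < Real.cos (Real.pi * ((z t').1.1 - r)) := by
        apply Real.cos_pos_of_mem_Ioo
        constructor <;> nlinarith [Real.pi_pos]
      rw [hsinx, hcosx, hcos]
      have hp := hpos t r hr
      have hn := hneg t r hr
      rw [letter] at hp hn
      rcases lt_or_gt_of_ne hxr with hlt | hgt
      · rw [liftCoord_of_mem (W := W) (r := r - 1) (by push_cast; linarith)
          (by push_cast; linarith)]
        have hsx : Real.sin (Real.pi * ((z t').1.1 - r)) < 0 := by
          apply Real.sin_neg_of_neg_of_neg_pi_lt <;> nlinarith [Real.pi_pos]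
        rcases lt_or_gt_of_ne hsin with h | h
        · have h' := neg_of_mul_pos_left hs h.le
          by_cases he : Even r
          · simp only [he, if_true, one_mul, mul_pos_of_neg_of_neg hsx h', h.not_gt, if_false]
          · simp [he, (mul_pos_of_neg_of_neg hsx h').not_gt, h, hcpos.not_gt, hn h]
        · have h' := pos_of_mul_pos_left hs h.le
          by_cases he : Even r
          · simp [he, (mul_neg_of_neg_of_pos hsx h').not_gt, h, hcpos, hp h]
          · simp [he, mul_neg_of_neg_of_pos hsx h', h.not_gt]
      · rw [liftCoord_of_mem (W := W) (r := r) hgt (by linarith)]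
        have hsx : 0 < Real.sin (Real.pi * ((z t').1.1 - r)) := by
          apply Real.sin_pos_of_pos_of_lt_pi <;> nlinarith [Real.pi_pos]
        rcases lt_or_gt_of_ne hsin with h | h
        · have h' := neg_of_mul_pos_left hs h.le
          by_cases he : Even r
          · simp [he, (mul_neg_of_pos_of_neg hsx h').not_gt, h.not_gt, hcpos, hn h]
          · simp [he, mul_neg_of_pos_of_neg hsx h', h]
        · have h' := pos_of_mul_pos_left hs h.le
          by_cases he : Even r
          · simp [he, mul_pos hsx h', h]
          · simp [he, (mul_pos hsx h').not_gt, h.not_gt, hcpos.not_gt, hp h]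

end

/-! ### Holonomy of lines and of loops around punctures -/

section

theorem sin_pi_mul_pos_of_even {y : ℝ} {k : ℤ} (h1 : (k : ℝ) < y) (h2 : y < k + 1)
    (hk : Even k) : 0 < Real.sin (Real.pi * y) := by
  have hd : Real.pi * y = Real.pi * (y - k) + k * Real.pi := by ring
  rw [hd, Real.sin_add_int_mul_pi, hk.neg_one_zpow, one_mul]
  apply Real.sin_pos_of_pos_of_lt_pi <;> nlinarith [Real.pi_pos]

theorem sin_pi_mul_neg_of_odd {y : ℝ} {k : ℤ} (h1 : (k : ℝ) < y) (h2 : y < k + 1)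
    (hk : ¬ Even k) : Real.sin (Real.pi * y) < 0 := by
  have hd : Real.pi * y = Real.pi * (y - k) + k * Real.pi := by ring
  rw [hd, Real.sin_add_int_mul_pi, (Int.not_even_iff_odd.1 hk).neg_one_zpow, neg_one_mul,
    neg_lt_zero]
  apply Real.sin_pos_of_pos_of_lt_pi <;> nlinarith [Real.pi_pos]

variable {G : Type*} [Group G]

/-- The product of the first `k` letters read along a line of slope `q / p`: crossing the line
`x = i` contributes the generator attached to it or its inverse, according to the parity of
`⌊i q / p⌋`. -/
def lineWord (a b : G) (p q : ℤ) : ℕ → G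
  | 0 => 1
  | k + 1 => lineWord a b p q k * letter a b k ^ (if Even (q * k / p) then 1 else -1 : ℤ)

section

variable [TopologicalSpace G] [DiscreteTopology G]

/-- The holonomy of a projected path, from the values on the strips it passes through. -/
theorem hol_proj (a b : G) {u v : ConwaySphere} (γ : Path u v)
    (z : unitInterval → PuncturedPlane) (hz : Continuous z) (hγ : ∀ t, γ t = proj (z t)) (W : ℤ → G)
    (hW : ∀ t (r k : ℤ), (z t).1.1 = r → (k : ℝ) < (z t).1.2 → (z t).1.2 < k + 1 →
      W r = letter a b r ^ (if Even k then -1 else 1 : ℤ) * W (r - 1)) :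
    (tangleCocycle a b).hol (Path.Homotopic.Quotient.mk γ) =
      liftCoord W (z 1).1.1 (z 1).1.2 * (liftCoord W (z 0).1.1 (z 0).1.2)⁻¹ := by
  have hc := continuous_liftCoord a b hz W ?_ ?_
  · refine (tangleCocycle a b).hol_mk γ (fun t => liftCoord W (z t).1.1 (z t).1.2) ?_
    simpa only [hγ] using hc
  all_goals
    intro t r hr hs
    have hy : (⌊(z t).1.2⌋ : ℝ) < (z t).1.2 := by
      refine (Int.floor_le _).lt_of_ne fun h => hs.ne' ?_
      first
        | exact (sin_pi_mul_eq_zero_iff.2 ⟨_, h.symm⟩).symm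
        | exact sin_pi_mul_eq_zero_iff.2 ⟨_, h.symm⟩
    have h := hW t r _ hr hy (Int.lt_floor_add_one _)
  · rwa [if_pos, zpow_neg_one] at h
    by_contra he
    exact hs.not_gt (sin_pi_mul_neg_of_odd hy (Int.lt_floor_add_one _) he)
  · rwa [if_neg, zpow_one] at h
    intro he
    exact hs.not_gt (sin_pi_mul_pos_of_even hy (Int.lt_floor_add_one _) he)

theorem abs_linePoint_start_lt {p q : ℤ} (hp : 0 < p) :
    |(q : ℝ) / (2 * ((p : ℝ) ^ 2 + (q : ℝ) ^ 2))| < 1 / 2 := by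
  have hp' : (1 : ℝ) ≤ p := by exact_mod_cast hp
  have h : (0 : ℝ) < 2 * ((p : ℝ) ^ 2 + (q : ℝ) ^ 2) := by positivity
  rw [abs_div, abs_of_pos h, div_lt_iff₀ h]
  have : |(q : ℝ)| < (p : ℝ) ^ 2 + (q : ℝ) ^ 2 := by
    rw [← sq_abs (q : ℝ)]
    nlinarith [sq_nonneg (|(q : ℝ)| - 1 / 2)]
  linarith

/-- The holonomy along a projected line is computed from the strips that contain its end points. -/
theorem hol_lineLoop (a b : G) {p q : ℤ} (h : IsCoprime p q) (hp : 0 < p) :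
    (tangleCocycle a b).hol (Path.Homotopic.Quotient.mk (lineLoop p q h)) =
      liftCoord (fun r => (lineWord a b p q (r + 1).toNat)⁻¹) (linePoint p q 1).1
          (linePoint p q 1).2 *
        (liftCoord (fun r => (lineWord a b p q (r + 1).toNat)⁻¹) (linePoint p q 0).1
          (linePoint p q 0).2)⁻¹ := by
  refine hol_proj a b (lineLoop p q h) (fun t => ⟨linePoint p q t, linePoint_not_mem h t⟩)
    (((continuous_linePoint p q).comp continuous_subtype_val).subtype_mk _) (fun _ => rfl) _ ?_
  intro t r k hr hk1 hk2
  have hp' : (0 : ℝ) < p := by exact_mod_cast hp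
  have hr0 : 0 ≤ r := by
    have h1 := (abs_lt.1 (abs_linePoint_start_lt (q := q) hp)).2
    have h2 : 0 ≤ (t : ℝ) * (2 * p) := mul_nonneg t.2.1 (by linarith)
    simp only [linePoint, neg_div] at hr
    -- The line starts to the right of `x = -1/2`, so it only crosses lines `x = r` with `r ≥ 0`.
    have h3 : ((-1 : ℤ) : ℝ) < r := by push_cast; linarith
    have := Int.cast_lt.1 h3
    omega
  have he := linePoint_equation h t
  simp only at hr hk1 hk2
  rw [hr] at he
  have hk : q * r / p = k := by
    refine Int.ediv_eq_iff_of_pos hp |>.2 ⟨?_, ?_⟩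
    · have : ((2 * (k * p) : ℤ) : ℝ) < ((2 * (q * r) + 1 : ℤ) : ℝ) := by
        push_cast; nlinarith
      have := Int.cast_lt.1 this
      linarith
    · have : ((2 * (q * r) + 1 : ℤ) : ℝ) < ((2 * ((k + 1) * p) : ℤ) : ℝ) := by
        push_cast; nlinarith
      have := Int.cast_lt.1 this
      linarith
  obtain ⟨j, rfl⟩ := Int.eq_ofNat_of_zero_le hr0
  have e1 : ((j : ℤ) + 1).toNat = j + 1 := by omega
  have e2 : ((j : ℤ) - 1 + 1).toNat = j := by omega
  simp only [e1, e2, lineWord, mul_inv_rev, hk]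
  split_ifs <;> simp

/-- The line starts in the strip `-1 < x < 0` and ends in the strip `2 p - 1 < x < 2 p`. -/
theorem hol_lineLoop_of_pos (a b : G) {p q : ℤ} (h : IsCoprime p q) (hp : 0 < p) (hq : 0 < q) :
    (tangleCocycle a b).hol (Path.Homotopic.Quotient.mk (lineLoop p q h)) =
      (lineWord a b p q (2 * p.toNat))⁻¹ := by
  have hp' : (0 : ℝ) < p := by exact_mod_cast hp
  have hq' : (0 : ℝ) < q := by exact_mod_cast hq
  have h1 := (abs_lt.1 (abs_linePoint_start_lt (q := q) hp)).2
  have h2 : 0 < (q : ℝ) / (2 * ((p : ℝ) ^ 2 + (q : ℝ) ^ 2)) := by positivity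
  rw [hol_lineLoop a b h hp, liftCoord_of_mem (r := 2 * p - 1), liftCoord_of_mem (r := -1)]
  · have e : (2 * p).toNat = 2 * p.toNat := by omega
    simp [e, lineWord]
  all_goals
    simp only [linePoint, neg_div]
    push_cast
    linarith

/-- Here both end points lie on vertical lines, so the chart around these lines is used. -/
theorem hol_lineLoop_zero (a b : G) (h : IsCoprime (1 : ℤ) 0) :
    (tangleCocycle a b).hol (Path.Homotopic.Quotient.mk (lineLoop 1 0 h)) = (b * a)⁻¹ := by
  rw [hol_lineLoop a b h one_pos]
  have e0 : linePoint 1 0 0 = (((0 : ℤ) : ℝ), 1 / 2) := by ext <;> simp [linePoint]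
  have e1 : linePoint 1 0 1 = (((2 : ℤ) : ℝ), 1 / 2) := by ext <;> simp [linePoint]
  have c2 : Real.cos (Real.pi * 2) = 1 := by rw [mul_comm]; exact Real.cos_two_pi
  have s2 : Real.sin (Real.pi * (1 / 2)) = 1 := by rw [mul_one_div]; exact Real.sin_pi_div_two
  rw [e0, e1, liftCoord, liftCoord, Int.floor_intCast, Int.floor_intCast, if_pos rfl, if_pos rfl]
  have t3 : ((2 : ℤ) + 1).toNat = 3 := rfl
  have t1 : ((0 : ℤ) + 1).toNat = 1 := rfl
  simp only [Int.cast_ofNat, c2, s2, Int.cast_zero, mul_zero, Real.cos_zero, one_mul, one_pos,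
    if_true, t3, t1, lineWord]
  simp [letter, mul_assoc]

theorem hol_lineLoop_infty (a b : G) (h : IsCoprime (0 : ℤ) 1) :
    (tangleCocycle a b).hol (Path.Homotopic.Quotient.mk (lineLoop 0 1 h)) = 1 := by
  rw [hol_proj a b (lineLoop 0 1 h) (fun t => ⟨linePoint 0 1 t, linePoint_not_mem h t⟩)
    (((continuous_linePoint 0 1).comp continuous_subtype_val).subtype_mk _) (fun _ => rfl)
    (fun _ => 1)]
  · simp [liftCoord]
  · intro t r k hr
    have h2 : ((2 * r : ℤ) : ℝ) = ((-1 : ℤ) : ℝ) := by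
      simp only [linePoint] at hr
      push_cast at hr ⊢
      linarith
    have := Int.cast_injective h2
    omega

theorem hol_punctureLoop (a b : G) (m : ℤ × ℤ) :
    (tangleCocycle a b).hol (Path.Homotopic.Quotient.mk (punctureLoop m)) =
      letter a b m.1 ^ (if Even m.2 then 1 else -1 : ℤ) := by
  rw [hol_proj a b (punctureLoop m) (fun t => ⟨circlePoint m t, circlePoint_not_mem m t⟩)
    (((continuous_circlePoint m).comp continuous_subtype_val).subtype_mk _) (fun _ => rfl)
    (fun r => if m.1 ≤ r then 1 else letter a b m.1 ^ (if Even m.2 then 1 else -1 : ℤ))]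
  · rw [liftCoord_of_mem (r := m.1 - 1), liftCoord_of_mem (r := m.1)]
    · simp
    all_goals
      simp [circlePoint]
      try linarith
  · intro t r k hr hk1 hk2
    have hc := Real.cos_sq_add_sin_sq (Real.pi * t)
    have hs : 0 ≤ Real.sin (Real.pi * t) := by
      apply Real.sin_nonneg_of_nonneg_of_le_pi
      · exact mul_nonneg Real.pi_pos.le t.2.1
      · nlinarith [Real.pi_pos, t.2.2]
    simp only [circlePoint] at hr hk1 hk2
    have h1 := Real.cos_le_one (Real.pi * t)
    have h2 := Real.neg_one_le_cos (Real.pi * t)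
    have h3 : ((2 * m.1 - 1 : ℤ) : ℝ) ≤ ((2 * r : ℤ) : ℝ) := by push_cast; linarith
    have h4 : ((2 * r : ℤ) : ℝ) ≤ ((2 * m.1 + 1 : ℤ) : ℝ) := by push_cast; linarith
    have h5 := Int.cast_le.1 h3
    have h6 := Int.cast_le.1 h4
    have hrm : r = m.1 := by omega
    subst hrm
    have hc0 : Real.cos (Real.pi * t) = 0 := by linarith
    have hs1 : Real.sin (Real.pi * t) = 1 := by
      rw [hc0] at hc
      nlinarith
    rw [hs1] at hk1 hk2
    have h7 : ((2 * k : ℤ) : ℝ) < ((2 * m.2 + 1 : ℤ) : ℝ) := by push_cast; linarith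
    have h8 : ((2 * m.2 + 1 : ℤ) : ℝ) < ((2 * k + 2 : ℤ) : ℝ) := by push_cast; linarith
    have h9 := Int.cast_lt.1 h7
    have h10 := Int.cast_lt.1 h8
    have hk : k = m.2 := by omega
    subst hk
    split_ifs <;> simp_all

end

/-- The fundamental group of the Conway sphere maps to any group with two marked elements `a` and
`b` such that the loop of slope `∞` becomes trivial. The loops of the other slopes are sent to the
words read along a line, and the loops around the punctures to conjugates of `a` and `b`. -/
theorem exists_hom_of_pair (a b : G) (x₀ : ConwaySphere) :
    ∃ Φ : FundamentalGroup ConwaySphere x₀ →* G,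
      Φ (alphaInfty x₀) = 1 ∧ IsConj (b * a)⁻¹ (Φ (alpha x₀ 0)) ∧
      (∀ s : ℚ, 0 < s → IsConj (lineWord a b s.den s.num (2 * s.den))⁻¹ (Φ (alpha x₀ s))) ∧
      ∀ m : ℤ × ℤ, IsConj (letter a b m.1 ^ (if Even m.2 then 1 else -1 : ℤ))
        (Φ (ofLoop x₀ (punctureLoop m))) := by
  let _ : TopologicalSpace G := ⊥
  have : DiscreteTopology G := ⟨rfl⟩
  refine ⟨(tangleCocycle a b).holHom x₀, ?_, ?_, fun s hs => ?_, fun m => ?_⟩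
  · have h := (tangleCocycle a b).isConj_holHom_ofLoop x₀ (lineLoop 0 1 isCoprime_one_right)
    rw [hol_lineLoop_infty, isConj_one_right] at h
    exact h
  · have h := (tangleCocycle a b).isConj_holHom_ofLoop x₀
      (lineLoop 1 0 isCoprime_one_left)
    rw [hol_lineLoop_zero] at h
    exact h
  · have h := (tangleCocycle a b).isConj_holHom_ofLoop x₀
      (lineLoop s.den s.num (isCoprime_den_num s))
    rw [hol_lineLoop_of_pos a b _ (by exact_mod_cast s.den_pos) (Rat.num_pos.2 hs)] at h
    exact h
  · have h := (tangleCocycle a b).isConj_holHom_ofLoop x₀ (punctureLoop m)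
    rw [hol_punctureLoop] at h
    exact h

end

/-! ### Words read along lines, in blocks of constant sign -/

section

/-- The index `⌈j p / q⌉` of the first letter of the `j`-th block of letters of constant sign. -/
def mark (p q j : ℕ) : ℕ := (j * p) ⌈/⌉ q

theorem mark_le_iff {p q j k : ℕ} (hq : 0 < q) : mark p q j ≤ k ↔ j * p ≤ q * k :=
  ceilDiv_le_iff_le_mul hq

theorem mark_zero {p q : ℕ} (hq : 0 < q) : mark p q 0 = 0 :=
  Nat.le_zero.1 ((mark_le_iff hq).2 (by simp))

theorem mark_two_mul {p q : ℕ} (hq : 0 < q) : mark p q (2 * q) = 2 * p := by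
  apply le_antisymm
  · rw [mark_le_iff hq]; exact le_of_eq (by ring)
  · have h := (mark_le_iff (p := p) (j := 2 * q) hq).1 le_rfl
    have : q * (2 * p) ≤ q * mark p q (2 * q) := by linarith
    exact Nat.le_of_mul_le_mul_left this hq

/-- All the blocks have length `m` or `m + 1` if `m ≤ p / q ≤ m + 1`. -/
theorem mark_succ_bounds {p q m : ℕ} (hq : 0 < q) (h1 : m * q ≤ p) (h2 : p ≤ (m + 1) * q) (j : ℕ) :
    mark p q j + m ≤ mark p q (j + 1) ∧ mark p q (j + 1) ≤ mark p q j + (m + 1) := by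
  have hm := (mark_le_iff (p := p) (j := j) hq).1 le_rfl
  have hm' := (mark_le_iff (p := p) (j := j + 1) hq).1 le_rfl
  constructor
  · have hmm : m ≤ mark p q (j + 1) := by
      refine Nat.le_of_mul_le_mul_left (le_trans ?_ hm') hq
      nlinarith
    have : mark p q j ≤ mark p q (j + 1) - m := by
      rw [mark_le_iff hq, Nat.mul_sub]
      apply Nat.le_sub_of_add_le
      nlinarith
    omega
  · rw [mark_le_iff hq]
    nlinarith

variable {G : Type*} [Group G]

/-- The sign `(-1) ^ j` of the letters of the `j`-th block. -/
def blockSign (j : ℕ) : ℤ := if Even j then 1 else -1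

/-- The sign of the power of `a` that separates the blocks `j - 1` and `j`. -/
def turnSign (p q j : ℕ) : ℤ := if Even (j + mark p q j) then 1 else -1

/-- The number of letters `b ^ {±1}` in the `j`-th block. -/
def blockWeight (p q j : ℕ) : ℤ := (mark p q (j + 1) / 2 : ℕ) - (mark p q j / 2 : ℕ)

/-- The product of the first `j` pieces `c ^ (± e) * a ^ (± 1)`, one for each block of letters of
constant sign. -/
def blockWord (a c : G) (p q : ℕ) : ℕ → G
  | 0 => 1
  | j + 1 => blockWord a c p q j * c ^ (blockSign j * blockWeight p q j) * a ^ turnSign p q (j + 1)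

/-- The exponent of `a` by which the `k`-th partial word, ending in the `j`-th block, differs
from a product of complete pieces. -/
def tailExp (j k : ℕ) : ℤ := if Even j then (k % 2 : ℕ) else 1 - (k % 2 : ℕ)

theorem turnSign_add_tailExp (p q j : ℕ) :
    turnSign p q (j + 1) + tailExp (j + 1) (mark p q (j + 1)) = tailExp j (mark p q (j + 1)) := by
  have h := Nat.mod_two_eq_zero_or_one (mark p q (j + 1))
  rw [turnSign, tailExp, tailExp]
  simp only [Nat.even_iff]
  split_ifs <;> omega

/-- Appending the next letter of a block: for the generators `a` and `b = a⁻¹ * c`, a positive block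
`a b a b ...` is a power of `c` up to a power of `a` at its ends. -/
theorem tailExp_step (a c : G) (j k : ℕ) :
    c ^ (blockSign j * (k / 2 : ℕ)) * a ^ tailExp j k *
        letter a (a⁻¹ * c) k ^ (if Even j then 1 else -1 : ℤ) =
      c ^ (blockSign j * ((k + 1) / 2 : ℕ)) * a ^ tailExp j (k + 1) := by
  rcases Nat.even_or_odd' k with ⟨l, rfl | rfl⟩
  · have e1 : 2 * l / 2 = l := by omega
    have e2 : (2 * l + 1) / 2 = l := by omega
    have e3 : 2 * l % 2 = 0 := by omega
    have e4 : (2 * l + 1) % 2 = 1 := by omega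
    have e5 : Even ((2 * l : ℕ) : ℤ) := ⟨l, by push_cast; ring⟩
    rw [tailExp, tailExp, blockSign, letter, e1, e2, e3, e4, if_pos e5]
    split_ifs <;> simp
  · have e1 : (2 * l + 1) / 2 = l := by omega
    have e2 : (2 * l + 1 + 1) / 2 = l + 1 := by omega
    have e3 : (2 * l + 1) % 2 = 1 := by omega
    have e4 : (2 * l + 1 + 1) % 2 = 0 := by omega
    have e5 : ¬ Even ((2 * l + 1 : ℕ) : ℤ) := by
      rw [Int.not_even_iff_odd]; exact ⟨l, by push_cast; ring⟩
    rw [tailExp, tailExp, blockSign, letter, e1, e2, e3, e4, if_neg e5]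
    split_ifs
    · simp [mul_assoc, zpow_add]
    · simp [← mul_assoc, zpow_add]
      rw [← mul_inv_rev, ← mul_inv_rev, ← pow_succ, ← pow_succ']

/-- The word read along a line of slope `q / p ≤ 1`, with the letters grouped into blocks of
constant sign. -/
theorem lineWord_eq_blockWord_mul (a c : G) {p q : ℕ} (hq : 0 < q) (hqp : q ≤ p) (k : ℕ) :
    lineWord a (a⁻¹ * c) p q k = blockWord a c p q (q * k / p) *
      c ^ (blockSign (q * k / p) * (((k / 2 : ℕ) : ℤ) - (mark p q (q * k / p) / 2 : ℕ))) *
      a ^ tailExp (q * k / p) k := by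
  have hp : 0 < p := hq.trans_le hqp
  induction k with
  | zero => simp [lineWord, blockWord, mark_zero hq, tailExp]
  | succ k ih =>
    set j := q * k / p with hj
    have hdiv : ((q : ℤ) * k / p) = (j : ℤ) := by rw [hj]; push_cast; rfl
    have hpar : (if Even ((q : ℤ) * k / p) then 1 else -1 : ℤ) = if Even j then 1 else -1 := by
      rw [hdiv]; simp only [Int.even_coe_nat]
    have key : lineWord a (a⁻¹ * c) p q (k + 1) = blockWord a c p q j *
        c ^ (blockSign j * ((((k + 1) / 2 : ℕ) : ℤ) - (mark p q j / 2 : ℕ))) *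
        a ^ tailExp j (k + 1) := by
      have h := tailExp_step a c j k
      rw [lineWord, ih, hpar, mul_assoc, mul_assoc, mul_assoc,
        mul_sub, mul_sub, sub_eq_neg_add, sub_eq_neg_add, zpow_add, zpow_add, mul_assoc, mul_assoc,
        ← h]
      simp only [mul_assoc]
    have hk1 : j * p ≤ q * k := Nat.div_mul_le_self _ _
    have hk2 : q * k < (j + 1) * p := by
      rw [mul_comm (j + 1)]; exact Nat.lt_mul_div_succ (q * k) hp
    rcases lt_or_ge (q * (k + 1)) ((j + 1) * p) with hlt | hge
    · have hj' : q * (k + 1) / p = j :=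
        Nat.div_eq_of_lt_le (by nlinarith) hlt
      rw [hj', key]
    · have hj' : q * (k + 1) / p = j + 1 :=
        Nat.div_eq_of_lt_le hge (by nlinarith)
      have hmark : mark p q (j + 1) = k + 1 := by
        apply le_antisymm ((mark_le_iff hq).2 hge)
        by_contra hlt
        exact hk2.not_ge ((mark_le_iff hq).1 (by omega))
      rw [hj', key, blockWord, ← hmark, ← turnSign_add_tailExp, zpow_add]
      simp [blockWeight, mul_assoc]

theorem lineWord_eq_blockWord (a c : G) {p q : ℕ} (hq : 0 < q) (hqp : q ≤ p) :
    lineWord a (a⁻¹ * c) p q (2 * p) = blockWord a c p q (2 * q) := by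
  have hp : 0 < p := hq.trans_le hqp
  have h : q * (2 * p) / p = 2 * q := by
    rw [← mul_assoc, Nat.mul_div_cancel _ hp, mul_comm]
  rw [lineWord_eq_blockWord_mul a c hq hqp, h, mark_two_mul hq, tailExp]
  simp

end

/-! ### Matrices and the growth of traces -/

open Matrix Filter

/-- The diagonal matrix with entries `u` and `u⁻¹`. -/
def diagHom : ℂˣ →* GL (Fin 2) ℂ where
  toFun u := ⟨!![(u : ℂ), 0; 0, ((u⁻¹ : ℂˣ) : ℂ)], !![((u⁻¹ : ℂˣ) : ℂ), 0; 0, (u : ℂ)],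
    by ext i j; fin_cases i <;> fin_cases j <;> simp,
    by ext i j; fin_cases i <;> fin_cases j <;> simp⟩
  map_one' := by
    ext i j; fin_cases i <;> fin_cases j <;> simp
  map_mul' u v := by
    ext i j; fin_cases i <;> fin_cases j <;> simp [mul_comm]

/-- The matrix that acts by `u` on the image of the projection `!![x, y; -y, 1 - x]` and by `1` on
its kernel. -/
def ellipticMatrix (x y u : ℂ) : Matrix (Fin 2) (Fin 2) ℂ :=
  !![1 + (u - 1) * x, (u - 1) * y; -((u - 1) * y), 1 + (u - 1) * (1 - x)]

theorem ellipticMatrix_mul {x y : ℂ} (h : y ^ 2 = x * (x - 1)) (u v : ℂ) :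
    ellipticMatrix x y u * ellipticMatrix x y v = ellipticMatrix x y (u * v) := by
  ext i j
  fin_cases i <;> fin_cases j <;> simp [ellipticMatrix, Matrix.mul_apply, Fin.sum_univ_two]
  · linear_combination (-(u - 1) * (v - 1)) * h
  · ring
  · ring
  · linear_combination (-(u - 1) * (v - 1)) * h

theorem ellipticMatrix_one (x y : ℂ) : ellipticMatrix x y 1 = 1 := by
  ext i j
  fin_cases i <;> fin_cases j <;> simp [ellipticMatrix]

/-- `ellipticMatrix` as a one-parameter group. -/
def ellipticHom {x y : ℂ} (h : y ^ 2 = x * (x - 1)) : ℂˣ →* GL (Fin 2) ℂ where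
  toFun u := ⟨ellipticMatrix x y u, ellipticMatrix x y (u⁻¹ : ℂˣ),
    by rw [ellipticMatrix_mul h, Units.mul_inv, ellipticMatrix_one],
    by rw [ellipticMatrix_mul h, Units.inv_mul, ellipticMatrix_one]⟩
  map_one' := Units.ext (ellipticMatrix_one x y)
  map_mul' u v := Units.ext (ellipticMatrix_mul h u v).symm

theorem det_ellipticMatrix {x y : ℂ} (h : y ^ 2 = x * (x - 1)) (u : ℂ) :
    (ellipticMatrix x y u).det = u := by
  rw [ellipticMatrix, det_fin_two_of]
  linear_combination ((u - 1) ^ 2) * h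

theorem trace_conj_eq {g h : GL (Fin 2) ℂ} (hgh : IsConj g h) :
    (g : Matrix (Fin 2) (Fin 2) ℂ).trace = (h : Matrix (Fin 2) (Fin 2) ℂ).trace := by
  obtain ⟨k, rfl⟩ := isConj_iff.1 hgh
  rw [Units.val_mul, Units.val_mul, mul_assoc, Matrix.trace_mul_comm, mul_assoc, Units.inv_mul,
    mul_one]

theorem trace_inv (g : GL (Fin 2) ℂ) :
    ((g⁻¹ : GL (Fin 2) ℂ) : Matrix (Fin 2) (Fin 2) ℂ).trace =
      (g : Matrix (Fin 2) (Fin 2) ℂ).det⁻¹ * (g : Matrix (Fin 2) (Fin 2) ℂ).trace := by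
  rw [Matrix.coe_units_inv, Matrix.inv_def, Matrix.trace_smul, Matrix.adjugate_fin_two,
    Ring.inverse_eq_inv', Matrix.trace_fin_two, Matrix.trace_fin_two]
  simp [add_comm]

/-- The trace of a `2 × 2` matrix of finite order is a sum of two roots of unity. -/
theorem norm_trace_le_two {M : Matrix (Fin 2) (Fin 2) ℂ} {m : ℕ} (hm : 0 < m) (hM : M ^ m = 1) :
    ‖M.trace‖ ≤ 2 := by
  rw [Matrix.trace_eq_sum_roots_charpoly]
  have hroot : ∀ z ∈ M.charpoly.roots, ‖z‖ = 1 := by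
    intro z hz
    rw [Polynomial.mem_roots (Matrix.charpoly_monic M).ne_zero,
      ← Matrix.mem_spectrum_iff_isRoot_charpoly] at hz
    have h1 : z ^ m ∈ spectrum ℂ (M ^ m) := spectrum.pow_mem_pow M m hz
    rw [hM, spectrum.one_eq, Set.mem_singleton_iff] at h1
    exact Complex.norm_eq_one_of_pow_eq_one h1 hm.ne'
  calc ‖M.charpoly.roots.sum‖ ≤ (M.charpoly.roots.map fun z => ‖z‖).sum := by
        exact norm_multiset_sum_le _
    _ = (M.charpoly.roots.map fun _ => (1 : ℝ)).sum := by
        rw [Multiset.map_congr rfl hroot]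
    _ = Multiset.card M.charpoly.roots := by simp
    _ ≤ 2 := by
        have h := M.charpoly.card_roots'
        rw [Matrix.charpoly_natDegree_eq_dim, Fintype.card_fin] at h
        exact_mod_cast h

/-- The index in `Fin 2` of the eigenvector of `a` that dominates `a ^ (± 1)`. -/
def turnIndex (p q j : ℕ) : Fin 2 := if Even (j + mark p q j) then 0 else 1

/-- The entry of the power of `c` in the `j`-th piece of the block word between the dominating
directions of the neighbouring powers of `a`. -/
def blockEntry (x y : ℂ) (w : ℂˣ) (p q j : ℕ) : ℂ :=
  ellipticMatrix x y (w ^ (blockSign j * blockWeight p q j) : ℂˣ)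
    (turnIndex p q j) (turnIndex p q (j + 1))

/-- The element `diag(t, 1/t)` for real `t ≠ 0`, and the identity for `t = 0`. -/
def diagReal (t : ℝ) : GL (Fin 2) ℂ :=
  if h : t ≠ 0 then diagHom (Units.mk0 (t : ℂ) (Complex.ofReal_ne_zero.2 h)) else 1

/-- After division by `t`, the matrix `diag (t, 1/t) ^ (± 1)` converges to a projection. -/
theorem tendsto_diagReal_zpow (p q j : ℕ) :
    Tendsto (fun t : ℝ => ((t : ℂ)⁻¹) • ((diagReal t ^ turnSign p q j : GL (Fin 2) ℂ) :
      Matrix (Fin 2) (Fin 2) ℂ)) atTop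
      (𝓝 (Matrix.single (turnIndex p q j) (turnIndex p q j) 1)) := by
  have h0 : Tendsto (fun t : ℝ => (t : ℂ)⁻¹ * (t : ℂ)⁻¹) atTop (𝓝 0) := by
    have h := (Complex.continuous_ofReal.tendsto 0).comp tendsto_inv_atTop_zero
    have h' := h.mul h
    simpa [Function.comp_def] using h'
  refine tendsto_pi_nhds.2 fun r => tendsto_pi_nhds.2 fun s => ?_
  rw [turnSign, turnIndex]
  have hev : ∀ {f : ℝ → ℂ} {z : ℂ} {g : ℝ → ℂ}, Tendsto g atTop (𝓝 z) →
      (∀ t : ℝ, t ≠ 0 → g t = f t) → Tendsto f atTop (𝓝 z) := by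
    intro f z g hg hfg
    refine hg.congr' ?_
    filter_upwards [eventually_ne_atTop 0] with t ht using hfg t ht
  split_ifs
  all_goals
    fin_cases r <;> fin_cases s
  · exact hev (g := fun _ => 1) (by simp) fun t ht => by simp [diagReal, ht, diagHom]
  · exact hev (g := fun _ => 0) (by simp) fun t ht => by simp [diagReal, ht, diagHom]
  · exact hev (g := fun _ => 0) (by simp) fun t ht => by simp [diagReal, ht, diagHom]
  · exact hev (by simpa using h0) fun t ht => by simp [diagReal, ht, diagHom]
  · exact hev (by simpa using h0) fun t ht => by simp [diagReal, ht, diagHom]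
  · exact hev (g := fun _ => 0) (by simp) fun t ht => by simp [diagReal, ht, diagHom]
  · exact hev (g := fun _ => 0) (by simp) fun t ht => by simp [diagReal, ht, diagHom]
  · exact hev (g := fun _ => 1) (by simp) fun t ht => by simp [diagReal, ht, diagHom]

/-- The limit of the normalized block words as `t → ∞`. -/
def limitMatrix (x y : ℂ) (w : ℂˣ) (p q : ℕ) : ℕ → Matrix (Fin 2) (Fin 2) ℂ
  | 0 => 1
  | j + 1 => limitMatrix x y w p q j *
      ellipticMatrix x y (w ^ (blockSign j * blockWeight p q j) : ℂˣ) *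
      Matrix.single (turnIndex p q (j + 1)) (turnIndex p q (j + 1)) 1

/-- As each piece ends in a rank one projection, the entries of the limit are products of single
entries of the elliptic factors. -/
theorem limitMatrix_zero_row (x y : ℂ) (w : ℂˣ) {p q : ℕ} (hq : 0 < q) (j : ℕ) (s : Fin 2) :
    limitMatrix x y w p q j 0 s =
      if s = turnIndex p q j then ∏ l ∈ Finset.range j, blockEntry x y w p q l else 0 := by
  induction j generalizing s with
  | zero =>
    simp only [limitMatrix, turnIndex, mark_zero hq]
    simp [Matrix.one_apply, eq_comm]
  | succ j ih =>
    rw [limitMatrix, Finset.prod_range_succ]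
    by_cases hs : s = turnIndex p q (j + 1)
    · rw [if_pos hs, hs, Matrix.mul_single_apply_same, mul_one, Matrix.mul_apply,
        Finset.sum_eq_single (turnIndex p q j)]
      · rw [ih, if_pos rfl, blockEntry]
      · intro r _ hr
        rw [ih, if_neg hr, zero_mul]
      · simp
    · rw [if_neg hs, Matrix.mul_single_apply_of_ne _ _ _ _ _ hs]

theorem limitMatrix_succ_apply_of_ne (x y : ℂ) (w : ℂˣ) (p q j : ℕ) {r s : Fin 2}
    (hs : s ≠ turnIndex p q (j + 1)) : limitMatrix x y w p q (j + 1) r s = 0 := by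
  rw [limitMatrix, Matrix.mul_single_apply_of_ne _ _ _ _ _ hs]

theorem turnIndex_two_mul {p q : ℕ} (hq : 0 < q) : turnIndex p q (2 * q) = 0 := by
  rw [turnIndex, mark_two_mul hq, if_pos]
  exact (even_two_mul q).add (even_two_mul p)

theorem trace_limitMatrix (x y : ℂ) (w : ℂˣ) {p q : ℕ} (hq : 0 < q) :
    (limitMatrix x y w p q (2 * q)).trace =
      ∏ l ∈ Finset.range (2 * q), blockEntry x y w p q l := by
  obtain ⟨k, hk⟩ : ∃ k, 2 * q = k + 1 := ⟨2 * q - 1, by omega⟩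
  have h1 : limitMatrix x y w p q (2 * q) 1 1 = 0 := by
    have := turnIndex_two_mul (p := p) hq
    rw [hk] at this ⊢
    apply limitMatrix_succ_apply_of_ne
    rw [this]
    exact one_ne_zero
  rw [Matrix.trace_fin_two, h1, add_zero, limitMatrix_zero_row x y w hq, turnIndex_two_mul hq,
    if_pos rfl]

theorem tendsto_blockWord {x y : ℂ} (h : y ^ 2 = x * (x - 1)) (w : ℂˣ) (p q j : ℕ) :
    Tendsto (fun t : ℝ => ((t : ℂ)⁻¹ ^ j) •
      ((blockWord (diagReal t) (ellipticHom h w) p q j : GL (Fin 2) ℂ) :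
        Matrix (Fin 2) (Fin 2) ℂ)) atTop (𝓝 (limitMatrix x y w p q j)) := by
  induction j with
  | zero => simp [blockWord, limitMatrix]
  | succ j ih =>
    have hc : Tendsto (fun _ : ℝ =>
        ellipticMatrix x y (w ^ (blockSign j * blockWeight p q j) : ℂˣ)) atTop
        (𝓝 (ellipticMatrix x y (w ^ (blockSign j * blockWeight p q j) : ℂˣ))) :=
      tendsto_const_nhds
    refine ((ih.mul hc).mul (tendsto_diagReal_zpow p q (j + 1))).congr fun t => ?_
    rw [blockWord, ← map_zpow, pow_succ]
    simp only [Units.val_mul, Matrix.smul_mul, Matrix.mul_smul, smul_smul, mul_comm]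
    rfl

theorem tendsto_trace_blockWord {x y : ℂ} (h : y ^ 2 = x * (x - 1)) (w : ℂˣ) {p q : ℕ}
    (hq : 0 < q) :
    Tendsto (fun t : ℝ => ‖((blockWord (diagReal t) (ellipticHom h w) p q (2 * q) :
        GL (Fin 2) ℂ) : Matrix (Fin 2) (Fin 2) ℂ).trace‖ / t ^ (2 * q)) atTop
      (𝓝 (∏ l ∈ Finset.range (2 * q), ‖blockEntry x y w p q l‖)) := by
  have hc : Continuous fun M : Matrix (Fin 2) (Fin 2) ℂ => ‖M.trace‖ :=
    (Continuous.matrix_trace continuous_id).norm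
  have ht := (hc.tendsto _).comp (tendsto_blockWord h w p q (2 * q))
  rw [trace_limitMatrix x y w hq, norm_prod] at ht
  refine ht.congr' ?_
  filter_upwards [eventually_gt_atTop 0] with t ht0
  simp only [Function.comp_apply, Matrix.trace_smul, norm_smul, norm_pow, norm_inv,
    Complex.norm_real, Real.norm_of_nonneg ht0.le]
  rw [inv_pow, div_eq_inv_mul]

theorem norm_det_blockWord {x y : ℂ} (h : y ^ 2 = x * (x - 1)) {w : ℂˣ} (hw : ‖(w : ℂ)‖ = 1)
    (t : ℝ) (p q j : ℕ) :
    ‖((blockWord (diagReal t) (ellipticHom h w) p q j : GL (Fin 2) ℂ) :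
      Matrix (Fin 2) (Fin 2) ℂ).det‖ = 1 := by
  have hd : ∀ k : ℤ, ‖((diagReal t ^ k : GL (Fin 2) ℂ) : Matrix (Fin 2) (Fin 2) ℂ).det‖ = 1 := by
    intro k
    rw [diagReal]
    split_ifs with ht
    · rw [← map_zpow]
      simp [diagHom, Matrix.det_fin_two_of]
      exact mul_inv_cancel₀ (zpow_ne_zero _ (abs_ne_zero.2 ht))
    · simp
  induction j with
  | zero => simp [blockWord]
  | succ j ih =>
    rw [blockWord, Units.val_mul, Units.val_mul, Matrix.det_mul, Matrix.det_mul, norm_mul,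
      norm_mul, ih, hd, ← map_zpow]
    change 1 * ‖(ellipticMatrix x y (w ^ (blockSign j * blockWeight p q j) : ℂˣ)).det‖ * 1 = 1
    rw [det_ellipticMatrix h]
    simp [hw]

/-! ### Monotonicity of the leading coefficient in the slope -/

/-- The squared modulus of the off-diagonal entries of the `k`-th power of the elliptic matrix with
eigenvalues `exp (2 π i / n)` and `1` and parameter `y = 1 / sin (π / n) ^ 2`. The diagonal entries
have squared modulus `1 + rotWeight n k`. -/
def rotWeight (n : ℕ) (k : ℤ) : ℝ :=
  4 * Real.sin (Real.pi * k / n) ^ 2 / Real.sin (Real.pi / n) ^ 4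

/-- The product of the squared contributions of two blocks of length `l`, one that begins with
`a ^ {±1}` and one that begins with `b ^ {±1}`. -/
def blockNorm (n l : ℕ) : ℝ :=
  if Even l then rotWeight n (l / 2 : ℕ) ^ 2
  else (1 + rotWeight n (l / 2 : ℕ)) * (1 + rotWeight n (l / 2 + 1 : ℕ))

theorem rotWeight_neg (n : ℕ) (k : ℤ) : rotWeight n (-k) = rotWeight n k := by
  rw [rotWeight, rotWeight]
  push_cast
  rw [mul_neg, neg_div, Real.sin_neg, neg_sq]

theorem rotWeight_nonneg (n : ℕ) (k : ℤ) : 0 ≤ rotWeight n k := by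
  unfold rotWeight; positivity

theorem sin_pi_div_pos {n k : ℕ} (hk : 0 < k) (hkn : k < n) : 0 < Real.sin (Real.pi * k / n) := by
  have hn : (0 : ℝ) < n := by exact_mod_cast hk.trans hkn
  have hk' : (0 : ℝ) < k := by exact_mod_cast hk
  have hkn' : (k : ℝ) < n := by exact_mod_cast hkn
  apply Real.sin_pos_of_pos_of_lt_pi
  · positivity
  · rw [div_lt_iff₀ hn]
    exact mul_lt_mul_of_pos_left hkn' Real.pi_pos

/-- `sin (π (k + 1) / n)² - sin (π k / n)² = sin (π (2 k + 1) / n) sin (π / n)`. -/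
theorem sin_sq_sub_sin_sq (n k : ℕ) :
    Real.sin (Real.pi * (k + 1 : ℕ) / n) ^ 2 - Real.sin (Real.pi * k / n) ^ 2 =
      Real.sin (Real.pi * (2 * k + 1 : ℕ) / n) * Real.sin (Real.pi / n) := by
  have e1 : Real.pi * (k + 1 : ℕ) / n = Real.pi * k / n + Real.pi / n := by push_cast; ring
  have e2 : Real.pi * (2 * k + 1 : ℕ) / n = Real.pi * k / n + (Real.pi * k / n + Real.pi / n) := by
    push_cast; ring
  rw [e1, e2, Real.sin_add, Real.sin_add, Real.cos_add, Real.sin_add]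
  have h1 := Real.sin_sq_add_cos_sq (Real.pi * k / n)
  have h2 := Real.sin_sq_add_cos_sq (Real.pi / n)
  linear_combination (Real.sin (Real.pi * k / n) ^ 2) * h2

theorem sin_pi_div_le {n k : ℕ} (hk : 0 < k) (hkn : k < n) :
    Real.sin (Real.pi / n) ≤ Real.sin (Real.pi * k / n) := by
  have hn : (0 : ℝ) < n := by exact_mod_cast hk.trans hkn
  have key : ∀ k : ℕ, 0 < k → 2 * k ≤ n → Real.sin (Real.pi / n) ≤ Real.sin (Real.pi * k / n) := by
    intro k hk hkn
    have hk' : (1 : ℝ) ≤ k := by exact_mod_cast hk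
    have hkn' : (2 * k : ℝ) ≤ n := by exact_mod_cast hkn
    apply Real.sin_le_sin_of_le_of_le_pi_div_two
    · have : 0 < Real.pi / n := by positivity
      linarith [Real.pi_pos]
    · rw [div_le_div_iff₀ hn two_pos]
      nlinarith [Real.pi_pos]
    · gcongr
      nlinarith [Real.pi_pos]
  by_cases h : 2 * k ≤ n
  · exact key k hk h
  · have h1 := key (n - k) (by omega) (by omega)
    have e : Real.pi * ((n - k : ℕ) : ℝ) / n = Real.pi - Real.pi * k / n := by
      rw [Nat.cast_sub hkn.le]
      field_simp
    rwa [e, Real.sin_pi_sub] at h1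

theorem blockNorm_pos {n l : ℕ} (hn : 2 ≤ n) (hl : 0 < l) (hln : l ≤ n) : 0 < blockNorm n l := by
  rw [blockNorm]
  split_ifs with he
  · have hk : 0 < l / 2 := by obtain ⟨k, rfl⟩ := he; omega
    have h1 := sin_pi_div_pos (n := n) hk (by omega)
    have h2 := sin_pi_div_pos (n := n) one_pos (by omega)
    rw [Nat.cast_one, mul_one] at h2
    unfold rotWeight
    push_cast at h1 ⊢
    positivity
  · have := rotWeight_nonneg n (l / 2 : ℕ)
    have := rotWeight_nonneg n (l / 2 + 1 : ℕ)
    positivity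

/-- Longer blocks contribute more. This is where block lengths are required to be at most `n`, and
where the size of the parameter `1 / sin (π / n) ^ 2` matters. -/
theorem blockNorm_lt_succ {n l : ℕ} (hn : 2 ≤ n) (hl : 0 < l) (hln : l + 1 ≤ n) :
    blockNorm n l < blockNorm n (l + 1) := by
  have hs : 0 < Real.sin (Real.pi / n) := by
    have h := sin_pi_div_pos (n := n) one_pos (by omega)
    rwa [Nat.cast_one, mul_one] at h
  have hs1 : Real.sin (Real.pi / n) ≤ 1 := Real.sin_le_one _
  set s := Real.sin (Real.pi / n) with hsdef
  rcases Nat.even_or_odd' l with ⟨k, rfl | rfl⟩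
  · have e1 : 2 * k / 2 = k := by omega
    have e2 : (2 * k + 1) / 2 = k := by omega
    have o : ¬ Even (2 * k + 1) := by simp
    rw [blockNorm, blockNorm, if_pos (even_two_mul k), if_neg o, e1, e2]
    have hd := sin_sq_sub_sin_sq n k
    have hnn : 0 ≤ Real.sin (Real.pi * (2 * k + 1 : ℕ) / n) := by
      rcases hln.lt_or_eq with h | h
      · exact (sin_pi_div_pos (by omega) h).le
      · rw [h, mul_div_cancel_right₀ _ (by exact_mod_cast (by omega : n ≠ 0)), Real.sin_pi]
    have hle : rotWeight n (k : ℕ) ≤ rotWeight n (k + 1 : ℕ) := by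
      unfold rotWeight
      have : Real.sin (Real.pi * k / n) ^ 2 ≤ Real.sin (Real.pi * (k + 1 : ℕ) / n) ^ 2 := by
        have := mul_nonneg hnn hs.le
        linarith
      simp only [Int.cast_natCast]
      gcongr
    have := rotWeight_nonneg n (k : ℕ)
    nlinarith
  · have e1 : (2 * k + 1) / 2 = k := by omega
    have e2 : (2 * k + 1 + 1) / 2 = k + 1 := by omega
    have o : ¬ Even (2 * k + 1) := by simp
    have o' : Even (2 * k + 1 + 1) := ⟨k + 1, by ring⟩
    rw [blockNorm, blockNorm, if_neg o, if_pos o', e1, e2]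
    have hd := sin_sq_sub_sin_sq n k
    have h1 : s ≤ Real.sin (Real.pi * (2 * k + 1 : ℕ) / n) := sin_pi_div_le (by omega) (by omega)
    have h2 : s ≤ Real.sin (Real.pi * (k + 1 : ℕ) / n) := sin_pi_div_le (by omega) (by omega)
    simp only [rotWeight, Int.cast_natCast, ← hsdef]
    rw [← hsdef] at hd
    have hA1 := Real.sin_sq_le_one (Real.pi * k / n)
    have hB1 := Real.sin_sq_le_one (Real.pi * (k + 1 : ℕ) / n)
    have hA0 := sq_nonneg (Real.sin (Real.pi * k / n))
    have hBs : s ^ 2 ≤ Real.sin (Real.pi * (k + 1 : ℕ) / n) ^ 2 := pow_le_pow_left₀ hs.le h2 2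
    have hBA : s ^ 2 ≤ Real.sin (Real.pi * (k + 1 : ℕ) / n) ^ 2 -
        Real.sin (Real.pi * k / n) ^ 2 := by
      rw [hd, sq]; exact mul_le_mul_of_nonneg_right h1 hs.le
    set A := Real.sin (Real.pi * k / n) ^ 2
    set B := Real.sin (Real.pi * (k + 1 : ℕ) / n) ^ 2
    have hs4 : 0 < s ^ 4 := by positivity
    have hs41 : s ^ 4 ≤ 1 := pow_le_one₀ hs.le hs1
    have hprod : s ^ 4 ≤ B * (B - A) := by
      calc s ^ 4 = s ^ 2 * s ^ 2 := by ring
        _ ≤ B * (B - A) := mul_le_mul hBs hBA (by positivity)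
          (hA0.trans (by linarith [sq_nonneg s]))
    rw [show (1 + 4 * A / s ^ 4) * (1 + 4 * B / s ^ 4) =
      (s ^ 4 + 4 * A) * (s ^ 4 + 4 * B) / (s ^ 4) ^ 2 by field_simp,
      show (4 * B / s ^ 4) ^ 2 = (4 * B) ^ 2 / (s ^ 4) ^ 2 by ring]
    apply div_lt_div_of_pos_right _ (by positivity)
    nlinarith

/-- Piecewise linear interpolation, rescaled by `q`: the value at `p / q` of the function that is
affine on each `[m, m + 1]` with `m < n` and agrees with `h` at the integers. The last piece is
extended beyond `n`, so that `p = n q` falls into it and `h (n + 1)` is not used. -/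
def interp (h : ℕ → ℝ) (n q p : ℕ) : ℝ :=
  q * h (min (p / q) (n - 1)) +
    (p - q * (min (p / q) (n - 1) : ℕ)) * (h (min (p / q) (n - 1) + 1) - h (min (p / q) (n - 1)))

theorem interp_lt {h : ℕ → ℝ} {n q p p' : ℕ} (hn : 2 ≤ n)
    (hh : ∀ l, 0 < l → l + 1 ≤ n → h l < h (l + 1)) (hq : 0 < q) (hp : q ≤ p) (hpp : p < p') :
    interp h n q p < interp h n q p' := by
  have hmono : ∀ l d, 0 < l → l + d ≤ n → h l ≤ h (l + d) := by
    intro l d hl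
    induction d with
    | zero => intro; exact le_rfl
    | succ d ih =>
      intro hd
      exact (ih (by omega)).trans (hh (l + d) (by omega) hd).le
  rw [interp, interp]
  have hm1 : 0 < p / q := Nat.div_pos hp hq
  have hmm : p / q ≤ p' / q := Nat.div_le_div_right hpp.le
  have hfl : q * (p / q) ≤ p := Nat.mul_div_le _ _
  have hfl' : q * (p' / q) ≤ p' := Nat.mul_div_le _ _
  have hlt : p < q * (p / q + 1) := Nat.lt_mul_div_succ _ hq
  set m := min (p / q) (n - 1) with hm
  set m' := min (p' / q) (n - 1) with hm'
  have hm0 : 0 < m := by omega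
  have hmn : m + 1 ≤ n := by omega
  have hmn' : m' + 1 ≤ n := by omega
  have hle : m ≤ m' := by omega
  have hqr : (0 : ℝ) < q := by exact_mod_cast hq
  have hppr : (p : ℝ) < p' := by exact_mod_cast hpp
  have hqm' : (q : ℝ) * m' ≤ p' := by
    exact_mod_cast (Nat.mul_le_mul_left q (min_le_left _ _)).trans hfl'
  have hd := hh m hm0 hmn
  have hd' := hh m' (by omega) hmn'
  rcases hle.eq_or_lt with heq | hlt'
  · rw [← heq]
    nlinarith
  · have hmp : m = p / q := by omega
    have hpr : (p : ℝ) < q * (m + 1) := by rw [hmp]; exact_mod_cast hlt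
    have h3 : h (m + 1) ≤ h m' := by
      have := hmono (m + 1) (m' - (m + 1)) (by omega) (by omega)
      rwa [Nat.add_sub_of_le hlt'] at this
    nlinarith

theorem norm_sq_entries {x y : ℝ} (h : y ^ 2 = x * (x - 1)) {u : ℂ} (hu : ‖u‖ = 1) (r s : Fin 2) :
    ‖ellipticMatrix x y u r s‖ ^ 2 =
      if r = s then 1 + y ^ 2 * ‖u - 1‖ ^ 2 else y ^ 2 * ‖u - 1‖ ^ 2 := by
  have hu' : u.re ^ 2 + u.im ^ 2 = 1 := by
    have h2 := Complex.sq_norm u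
    rw [hu, Complex.normSq_apply] at h2
    linarith
  have hu1 : ‖u - 1‖ ^ 2 = (u.re - 1) ^ 2 + u.im ^ 2 := by
    rw [Complex.sq_norm, Complex.normSq_apply]
    simp
    ring
  rw [hu1]
  fin_cases r <;> fin_cases s <;>
    simp [ellipticMatrix, Complex.sq_norm, Complex.normSq_apply]
  · linear_combination (x ^ 2 - y ^ 2) * hu' + (2 * u.re - 2) * h
  · rw [mul_pow, sq_abs, hu1]; ring
  · rw [mul_pow, sq_abs, hu1]; ring
  · linear_combination ((1 - x) ^ 2 - y ^ 2) * hu' + (2 * u.re - 2) * h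

/-! ### The leading coefficient and the exponent sums of a line word -/

/-- The primitive `n`-th root of unity `exp (2 π i / n)`. -/
def rootUnit (n : ℕ) : ℂˣ := Units.mk0 (Complex.exp (Complex.I * (2 * Real.pi / n : ℝ)))
  (Complex.exp_ne_zero _)

theorem rootUnit_zpow (n : ℕ) (k : ℤ) :
    ((rootUnit n ^ k : ℂˣ) : ℂ) = Complex.exp (Complex.I * (2 * (Real.pi * k / n) : ℝ)) := by
  rw [rootUnit, Units.val_zpow_eq_zpow_val, Units.val_mk0, ← Complex.exp_int_mul]
  congr 1
  push_cast
  ring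

theorem rootUnit_pow (n : ℕ) (hn : n ≠ 0) : rootUnit n ^ n = 1 := by
  ext
  have h := rootUnit_zpow n n
  rw [zpow_natCast] at h
  rw [h, Int.cast_natCast, mul_div_cancel_right₀ _ (by exact_mod_cast hn), mul_comm]
  push_cast
  exact Complex.exp_two_pi_mul_I

theorem norm_rootUnit_zpow (n : ℕ) (k : ℤ) : ‖((rootUnit n ^ k : ℂˣ) : ℂ)‖ = 1 := by
  rw [rootUnit_zpow, mul_comm, Complex.norm_exp_ofReal_mul_I]

theorem norm_rootUnit_zpow_sub_one (n : ℕ) (k : ℤ) :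
    ‖((rootUnit n ^ k : ℂˣ) : ℂ) - 1‖ ^ 2 = 4 * Real.sin (Real.pi * k / n) ^ 2 := by
  rw [rootUnit_zpow, Complex.norm_exp_I_mul_ofReal_sub_one, mul_div_cancel_left₀ _ two_ne_zero,
    Real.norm_eq_abs, sq_abs]
  ring

theorem rotWeight_blockSign_mul (j : ℕ) (n : ℕ) (k : ℤ) :
    rotWeight n (blockSign j * k) = rotWeight n k := by
  rw [blockSign]
  split_ifs
  · rw [one_mul]
  · rw [neg_one_mul, rotWeight_neg]

theorem norm_sq_blockEntry {n : ℕ} {x y : ℝ} (h : y ^ 2 = x * (x - 1))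
    (hy : y = 1 / Real.sin (Real.pi / n) ^ 2) (p q j l : ℕ)
    (hl : mark p q (j + 1) = mark p q j + l) :
    ‖blockEntry x y (rootUnit n) p q j‖ ^ 2 =
      if Even l then rotWeight n (blockWeight p q j) else 1 + rotWeight n (blockWeight p q j) := by
  have hw : ∀ k : ℤ, y ^ 2 * ‖((rootUnit n ^ k : ℂˣ) : ℂ) - 1‖ ^ 2 = rotWeight n k := by
    intro k
    rw [norm_rootUnit_zpow_sub_one, rotWeight, hy]
    ring
  rw [blockEntry, norm_sq_entries h (norm_rootUnit_zpow n _), hw, rotWeight_blockSign_mul]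
  have ht : turnIndex p q j = turnIndex p q (j + 1) ↔ ¬ Even l := by
    rw [turnIndex, turnIndex, hl]
    by_cases h1 : Even l <;> by_cases h2 : Even (j + mark p q j)
    all_goals
      have h3 : j + 1 + (mark p q j + l) = j + mark p q j + l + 1 := by ring
      rw [h3]
      simp [h1, h2, Nat.even_add]
  simp only [ht, ite_not]

/-- The logarithm of the contribution of a block is an affine function of its length `l` and of the
number of letters `b ^ {±1}` in it, as long as only two consecutive lengths occur. -/
theorem log_blockContribution {n m l M : ℕ} (hn : 2 ≤ n) (hl0 : 0 < l) (hln : l ≤ n)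
    (hl : l = m ∨ l = m + 1) (e : ℤ) (he : e = ((M + l) / 2 : ℕ) - (M / 2 : ℕ)) :
    0 < (if Even l then rotWeight n e else 1 + rotWeight n e) ∧
    Real.log (if Even l then rotWeight n e else 1 + rotWeight n e) =
      Real.log (blockNorm n l) / 2 + ((e : ℝ) - l / 2) *
        (Real.log (1 + rotWeight n (m / 2 + 1 : ℕ)) - Real.log (1 + rotWeight n (m / 2 : ℕ))) := by
  have hpos := blockNorm_pos hn hl0 hln
  have h1 : ∀ k, (1 + rotWeight n k) ≠ 0 := fun k => by
    have := rotWeight_nonneg n k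
    positivity
  rcases Nat.even_or_odd' l with ⟨i, rfl | rfl⟩
  · have hi : e = (i : ℕ) := by omega
    have hi2 : 2 * i / 2 = i := by omega
    rw [blockNorm, if_pos (even_two_mul i), hi2] at hpos
    rw [if_pos (even_two_mul i), hi, blockNorm, if_pos (even_two_mul i), hi2, Real.log_pow]
    have hne : rotWeight n (i : ℕ) ≠ 0 := fun h0 => by
      rw [h0] at hpos
      norm_num at hpos
    exact ⟨(rotWeight_nonneg n _).lt_of_ne hne.symm, by push_cast; ring⟩
  · have ho : ¬ Even (2 * i + 1) := by simp
    have him : m / 2 = i := by omega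
    have hi2 : (2 * i + 1) / 2 = i := by omega
    rw [if_neg ho, blockNorm, if_neg ho, hi2, him, Real.log_mul (h1 _) (h1 _)]
    have := rotWeight_nonneg n e
    refine ⟨by positivity, ?_⟩
    have hei : e = (i : ℕ) ∨ e = (i + 1 : ℕ) := by omega
    rcases hei with rfl | rfl
    all_goals
      push_cast
      ring

/-- The leading coefficient of the trace of the block word, in terms of the slope. -/
theorem log_prod_blockEntry {n p q : ℕ} (hn : 2 ≤ n) (hq : 0 < q) (hqp : q ≤ p) (hpn : p ≤ n * q)
    {x y : ℝ} (h : y ^ 2 = x * (x - 1)) (hy : y = 1 / Real.sin (Real.pi / n) ^ 2) :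
    0 < ∏ l ∈ Finset.range (2 * q), ‖blockEntry x y (rootUnit n) p q l‖ ∧
    Real.log ((∏ l ∈ Finset.range (2 * q), ‖blockEntry x y (rootUnit n) p q l‖) ^ 2) =
      interp (fun l => Real.log (blockNorm n l)) n q p := by
  have hm1 : 0 < p / q := Nat.div_pos hqp hq
  have hfl : q * (p / q) ≤ p := Nat.mul_div_le _ _
  have hlt : p < q * (p / q + 1) := Nat.lt_mul_div_succ _ hq
  rw [interp]
  set m := min (p / q) (n - 1) with hm
  have hm0 : 0 < m := by omega
  have hmn : m + 1 ≤ n := by omega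
  have hb1 : m * q ≤ p := by
    rw [mul_comm]
    exact (Nat.mul_le_mul_left q (min_le_left _ _)).trans hfl
  have hb2 : p ≤ (m + 1) * q := by
    rcases le_total (p / q) (n - 1) with hc | hc
    · rw [hm, min_eq_left hc, mul_comm]; exact hlt.le
    · rw [hm, min_eq_right hc, Nat.sub_add_cancel (by omega)]; exact hpn
  -- Summed over all blocks, an affine function of the lengths and the numbers of letters `b`
  -- depends only on the totals `2 p` and `p`.
  set κ := Real.log (1 + rotWeight n (m / 2 + 1 : ℕ)) - Real.log (1 + rotWeight n (m / 2 : ℕ))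
    with hκ
  set H := fun l => Real.log (blockNorm n l) with hH
  have key : ∀ j, 0 < ‖blockEntry x y (rootUnit n) p q j‖ ^ 2 ∧
      Real.log (‖blockEntry x y (rootUnit n) p q j‖ ^ 2) =
        (H m + (((mark p q (j + 1) : ℝ) - mark p q j) - m) * (H (m + 1) - H m)) / 2 +
        ((((mark p q (j + 1) / 2 : ℕ) : ℝ) - (mark p q j / 2 : ℕ)) -
          ((mark p q (j + 1) : ℝ) - mark p q j) / 2) * κ := by
    intro j
    obtain ⟨h1, h2⟩ := mark_succ_bounds hq hb1 hb2 j
    obtain ⟨l, hl⟩ := Nat.exists_eq_add_of_le ((Nat.le_add_right _ _).trans h1)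
    have hlm : l = m ∨ l = m + 1 := by omega
    obtain ⟨g1, g2⟩ := log_blockContribution (n := n) (m := m) (l := l) (M := mark p q j) hn
      (by omega) (by omega) hlm (blockWeight p q j) (by rw [blockWeight, hl])
    rw [norm_sq_blockEntry h hy p q j l hl]
    refine ⟨g1, ?_⟩
    rw [g2, ← hκ, blockWeight, hl]
    have hc : H l = H m + ((l : ℝ) - m) * (H (m + 1) - H m) := by
      rcases hlm with rfl | rfl
      · ring
      · push_cast; ring
    change H l / 2 + _ = _
    rw [hc, Int.cast_sub, Int.cast_natCast, Int.cast_natCast, Nat.cast_add]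
    ring
  constructor
  · exact Finset.prod_pos fun j _ => by
      have := (key j).1
      exact (norm_nonneg _).lt_of_ne fun h0 => by rw [← h0] at this; norm_num at this
  · rw [← Finset.prod_pow, Real.log_prod (fun j _ => (key j).1.ne'),
      Finset.sum_congr rfl fun j _ => (key j).2, Finset.sum_add_distrib, ← Finset.sum_div,
      ← Finset.sum_mul, Finset.sum_add_distrib, Finset.sum_sub_distrib, ← Finset.sum_mul,
      Finset.sum_sub_distrib, ← Finset.sum_div, Finset.sum_range_sub (fun j => (mark p q j : ℝ)),
      Finset.sum_range_sub (fun j => ((mark p q j / 2 : ℕ) : ℝ)), mark_two_mul hq, mark_zero hq]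
    simp only [Finset.sum_const, Finset.card_range, nsmul_eq_mul, Nat.zero_div,
      Nat.mul_div_cancel_left p two_pos]
    push_cast
    ring

section Abelian

variable {G : Type*} [CommGroup G]

/-- The sign of the `i`-th letter read along a line of slope `q / p`. -/
def letterSign (p q i : ℕ) : ℤ := if Even (q * i / p) then 1 else -1

theorem lineWord_two_mul (a b : G) (p q k : ℕ) :
    lineWord a b p q (2 * k) = a ^ (∑ j ∈ Finset.range k, letterSign p q (2 * j)) *
      b ^ (∑ j ∈ Finset.range k, letterSign p q (2 * j + 1)) := by
  have hs : ∀ i : ℕ, (if Even ((q : ℤ) * i / p) then 1 else -1 : ℤ) = letterSign p q i := by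
    intro i
    have : ((q : ℤ) * i / p) = ((q * i / p : ℕ) : ℤ) := by push_cast; rfl
    rw [this, letterSign]
    simp only [Int.even_coe_nat]
  induction k with
  | zero => simp [lineWord]
  | succ k ih =>
    have e1 : Even ((2 * k : ℕ) : ℤ) := ⟨k, by push_cast; ring⟩
    have e2 : ¬ Even ((2 * k + 1 : ℕ) : ℤ) := by
      rw [Int.not_even_iff_odd]; exact ⟨k, by push_cast; ring⟩
    rw [Finset.sum_range_succ, Finset.sum_range_succ, _root_.zpow_add, _root_.zpow_add,
      show 2 * (k + 1) = 2 * k + 1 + 1 by ring, lineWord, lineWord, ih, hs, hs, letter, letter,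
      if_pos e1, if_neg e2]
    simp only [mul_assoc, mul_left_comm]

theorem letterSign_reflect {p q i : ℕ} (hpq : p.Coprime q) (hi : i < 2 * p) (hi0 : 0 < i)
    (hip : i ≠ p) : letterSign p q (2 * p - i) = -letterSign p q i := by
  have hp : 0 < p := by omega
  have hnd : ¬ p ∣ q * i := by
    intro hd
    obtain ⟨k, hk⟩ := hpq.dvd_of_dvd_mul_left hd
    have h2 : p * k < p * 2 := by rw [← hk, mul_comm p]; exact hi
    have h3 := Nat.lt_of_mul_lt_mul_left h2
    interval_cases k <;> omega
  have hmod : 0 < q * i % p := Nat.pos_of_ne_zero fun h0 => hnd (Nat.dvd_of_mod_eq_zero h0)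
  have hmod' := Nat.mod_lt (q * i) hp
  have hdm := Nat.div_add_mod (q * i) p
  set k := q * i / p with hk
  set r := q * i % p
  have hbig : q * i < p * (2 * q) := by
    have hq : 0 < q := Nat.pos_of_ne_zero fun h0 => by simp [h0] at hnd
    nlinarith
  have hk2 : k < 2 * q := by
    by_contra hcon
    have := Nat.mul_le_mul_left p (not_lt.1 hcon)
    omega
  have e : q * (2 * p - i) / p = 2 * q - 1 - k := by
    obtain ⟨d, hd⟩ := Nat.exists_eq_add_of_lt hk2
    have e1 : 2 * q - 1 - k = d := by omega
    rw [e1, Nat.mul_sub]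
    have e2 : q * (2 * p) = p * k + p * d + p := by
      rw [show q * (2 * p) = p * (2 * q) by ring, hd]; ring
    apply Nat.div_eq_of_lt_le
    · rw [mul_comm d]; omega
    · rw [add_mul, mul_comm d]; omega
  rw [letterSign, letterSign, e, ← hk]
  have : Even (2 * q - 1 - k) ↔ ¬ Even k := by
    rw [Nat.even_iff, Nat.even_iff]; omega
  simp only [this]
  split_ifs <;> rfl

theorem letterSign_add_reflect {p q i : ℕ} (hpq : p.Coprime q) (hi : i < 2 * p) (hi0 : 0 < i) :
    letterSign p q i + letterSign p q (2 * p - i) = if i = p then 2 * letterSign p q p else 0 := by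
  split_ifs with h
  · rw [h, two_mul p, Nat.add_sub_cancel, two_mul]
  · rw [letterSign_reflect hpq hi hi0 h, add_neg_cancel]

/-- The reflection `i ↦ 2 p - i` cancels the signs of all odd positions except `i = p`. -/
theorem sum_letterSign_odd {p q : ℕ} (hpq : p.Coprime q) :
    ∑ j ∈ Finset.range p, letterSign p q (2 * j + 1) = if Even p then 0 else letterSign p q p := by
  have h : 2 * ∑ j ∈ Finset.range p, letterSign p q (2 * j + 1) =
      ∑ j ∈ Finset.range p, if 2 * j + 1 = p then 2 * letterSign p q p else 0 := by
    rw [two_mul]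
    nth_rewrite 2 [← Finset.sum_range_reflect]
    rw [← Finset.sum_add_distrib]
    refine Finset.sum_congr rfl fun j hj => ?_
    have hj' := Finset.mem_range.1 hj
    rw [← letterSign_add_reflect hpq (by omega) (by omega)]
    congr 2
    omega
  rcases Nat.even_or_odd' p with ⟨k, hk | hk⟩
  · rw [Finset.sum_eq_zero fun j _ => if_neg (by omega)] at h
    rw [if_pos (hk ▸ even_two_mul k)]
    omega
  · rw [Finset.sum_eq_single k (fun j _ hj => if_neg (by omega))
      (fun hn => absurd (Finset.mem_range.2 (by omega)) hn), if_pos hk.symm] at h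
    rw [if_neg (by rw [hk]; simp)]
    omega

/-- The reflection `i ↦ 2 p - i` cancels the signs of all even positions except `0` and `p`. -/
theorem sum_letterSign_even {p q : ℕ} (hp : 0 < p) (hpq : p.Coprime q) :
    ∑ j ∈ Finset.range p, letterSign p q (2 * j) = 1 + if Even p then letterSign p q p else 0 := by
  have h : 2 * ∑ j ∈ Finset.range (p - 1), letterSign p q (2 * (j + 1)) =
      ∑ j ∈ Finset.range (p - 1), if 2 * (j + 1) = p then 2 * letterSign p q p else 0 := by
    rw [two_mul]
    nth_rewrite 2 [← Finset.sum_range_reflect]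
    rw [← Finset.sum_add_distrib]
    refine Finset.sum_congr rfl fun j hj => ?_
    have hj' := Finset.mem_range.1 hj
    rw [← letterSign_add_reflect hpq (by omega) (by omega)]
    congr 2
    omega
  have h0 : ∑ j ∈ Finset.range p, letterSign p q (2 * j) =
      ∑ j ∈ Finset.range (p - 1), letterSign p q (2 * (j + 1)) + 1 := by
    obtain ⟨p', rfl⟩ : ∃ p', p = p' + 1 := ⟨p - 1, by omega⟩
    rw [Finset.sum_range_succ', Nat.add_sub_cancel]
    simp [letterSign]
  rw [h0]
  rcases Nat.even_or_odd' p with ⟨k, hk | hk⟩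
  · rw [Finset.sum_eq_single (k - 1) (fun j _ hj => if_neg (by omega))
      (fun hn => absurd (Finset.mem_range.2 (by omega)) hn), if_pos (by omega)] at h
    rw [if_pos (hk ▸ even_two_mul k)]
    omega
  · rw [Finset.sum_eq_zero fun j _ => if_neg (by omega)] at h
    rw [if_neg (by rw [hk]; simp)]
    omega

theorem letterSign_self {p : ℕ} (hp : 0 < p) (q : ℕ) :
    letterSign p q p = if Even q then 1 else -1 := by
  rw [letterSign, Nat.mul_div_cancel _ hp]

end Abelian

/-! ### Representations of the Heckoid group -/

/-- Elements `a` and `c` of a group with `c ^ n = 1` give a homomorphism from `Hecke(0; n)`. -/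
theorem exists_heckeHom {G : Type*} [Group G] (a c : G) {n : ℕ} (hc : c ^ n = 1)
    (x₀ : ConwaySphere) :
    ∃ Ψ : Hecke x₀ n →* G, IsConj c⁻¹ (Ψ (heckeAlpha x₀ n 0)) ∧
      (∀ s : ℚ, 0 < s → IsConj (lineWord a (a⁻¹ * c) s.den s.num (2 * s.den))⁻¹
        (Ψ (heckeAlpha x₀ n s))) ∧
      ∀ m : ℤ × ℤ, IsConj (letter a (a⁻¹ * c) m.1 ^ (if Even m.2 then 1 else -1 : ℤ))
        (Ψ (meridian x₀ n m)) := by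
  obtain ⟨Φ, h1, h2, h3, h4⟩ := exists_hom_of_pair a (a⁻¹ * c) x₀
  have h2' : IsConj c⁻¹ (Φ (alpha x₀ 0)) :=
    IsConj.trans (isConj_iff.2 ⟨a⁻¹, by group⟩) h2
  have hker : Subgroup.normalClosure {alphaInfty x₀, alpha x₀ 0 ^ n} ≤ Φ.ker := by
    refine Subgroup.normalClosure_le_normal ?_
    rintro g (rfl | rfl)
    · exact h1
    · have h := h2'.pow n
      rw [inv_pow, hc, inv_one, isConj_one_right] at h
      exact (map_pow Φ _ n).trans h
  exact ⟨QuotientGroup.lift _ Φ hker, h2', h3, h4⟩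

theorem slope_bounds {n : ℕ} (hn : 2 ≤ n) {s : ℚ} (hs : s ∈ Set.Icc (1 / (n : ℚ)) 1) :
    ∃ q : ℕ, s.num = q ∧ 0 < q ∧ q ≤ s.den ∧ s.den ≤ n * q ∧ 0 < s := by
  have hn0 : (0 : ℚ) < n := by exact_mod_cast (by omega : 0 < n)
  have hs0 : 0 < s := lt_of_lt_of_le (by positivity) hs.1
  obtain ⟨q, hq⟩ := Int.eq_ofNat_of_zero_le (Rat.num_pos.2 hs0).le
  have hd : (0 : ℚ) < s.den := by exact_mod_cast s.den_pos
  have he : s = (q : ℚ) / s.den := by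
    conv_lhs => rw [← Rat.num_div_den s, hq]
    simp
  refine ⟨q, hq, by have := Rat.num_pos.2 hs0; omega, ?_, ?_, hs0⟩
  · have h := hs.2
    rw [he, div_le_one hd] at h
    exact_mod_cast h
  · have h := hs.1
    rw [he, div_le_div_iff₀ hn0 hd, one_mul, mul_comm] at h
    exact_mod_cast h

theorem tendsto_growth_unique {f : ℝ → ℝ} {i j : ℕ} {L L' : ℝ} (hL' : 0 < L')
    (hi : Tendsto (fun t => f t / t ^ i) atTop (𝓝 L))
    (hj : Tendsto (fun t => f t / t ^ j) atTop (𝓝 L')) : j ≤ i := by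
  by_contra hlt
  obtain ⟨d, rfl⟩ := Nat.exists_eq_add_of_lt (not_le.1 hlt)
  have h0 : Tendsto (fun t : ℝ => (t⁻¹) ^ (d + 1)) atTop (𝓝 0) := by
    have := tendsto_inv_atTop_zero (𝕜 := ℝ) |>.pow (d + 1)
    rwa [zero_pow (Nat.succ_ne_zero d)] at this
  have h1 := hi.mul h0
  rw [mul_zero] at h1
  refine hL'.ne' (tendsto_nhds_unique hj (h1.congr' ?_))
  filter_upwards [eventually_ne_atTop 0] with t ht
  rw [add_assoc, pow_add, inv_pow]
  field_simp
  ring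

/-- A one-parameter family of representations of `Hecke(0; n)` for which the growth rate of the
trace of `α_s` and its leading coefficient are functions of the slope. -/
theorem exists_traceFamily {n : ℕ} (hn : 2 ≤ n) (x₀ : ConwaySphere) :
    ∃ Ψ : ℝ → (Hecke x₀ n →* GL (Fin 2) ℂ), ∀ s : ℚ, s ∈ Set.Icc (1 / (n : ℚ)) 1 →
      (∃ L : ℝ, 0 < L ∧
        Real.log (L ^ 2) = interp (fun l => Real.log (blockNorm n l)) n s.num.toNat s.den ∧
        Tendsto (fun t => ‖(Ψ t (heckeAlpha x₀ n s) : Matrix (Fin 2) (Fin 2) ℂ).trace‖ /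
          t ^ (2 * s.num.toNat)) atTop (𝓝 L)) ∧
      ∀ t, ‖((Ψ t (heckeAlpha x₀ n s))⁻¹ : GL (Fin 2) ℂ).val.trace‖ =
        ‖(Ψ t (heckeAlpha x₀ n s) : Matrix (Fin 2) (Fin 2) ℂ).trace‖ := by
  obtain ⟨y, hy⟩ : ∃ y : ℝ, y = 1 / Real.sin (Real.pi / n) ^ 2 := ⟨_, rfl⟩
  obtain ⟨x, hx⟩ : ∃ x : ℝ, y ^ 2 = x * (x - 1) := by
    refine ⟨(1 + √(1 + 4 * y ^ 2)) / 2, ?_⟩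
    have := Real.sq_sqrt (by positivity : (0 : ℝ) ≤ 1 + 4 * y ^ 2)
    linear_combination (-1 / 4) * this
  have hxc : (y : ℂ) ^ 2 = (x : ℂ) * ((x : ℂ) - 1) := by exact_mod_cast hx
  have hcn : ellipticHom hxc (rootUnit n) ^ n = 1 := by
    rw [← map_pow, rootUnit_pow n (by omega), map_one]
  choose Ψ _ hΨ _ using fun t => exists_heckeHom (diagReal t) (ellipticHom hxc (rootUnit n)) hcn x₀
  refine ⟨Ψ, fun s hs => ?_⟩
  obtain ⟨q, hq, hq0, hqp, hpn, hs0⟩ := slope_bounds hn hs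
  have hqn : s.num.toNat = q := by rw [hq]; rfl
  rw [hqn]
  obtain ⟨W, hW⟩ : ∃ W : ℝ → GL (Fin 2) ℂ, ∀ t,
      W t = blockWord (diagReal t) (ellipticHom hxc (rootUnit n)) s.den q (2 * q) :=
    ⟨_, fun _ => rfl⟩
  have hconj : ∀ t, IsConj (W t)⁻¹ (Ψ t (heckeAlpha x₀ n s)) := by
    intro t
    have h := hΨ t s hs0
    rwa [hq, lineWord_eq_blockWord _ _ hq0 hqp, ← hW] at h
  have hw1 : ‖(rootUnit n : ℂ)‖ = 1 := by simpa using norm_rootUnit_zpow n 1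
  have hdet : ∀ t, ‖(W t).val.det‖ = 1 := fun t => by
    rw [hW]; exact norm_det_blockWord hxc hw1 t s.den q (2 * q)
  have htr : ∀ t, ‖(Ψ t (heckeAlpha x₀ n s) : Matrix (Fin 2) (Fin 2) ℂ).trace‖ =
      ‖(W t).val.trace‖ := by
    intro t
    rw [← trace_conj_eq (hconj t), trace_inv, norm_mul, norm_inv, hdet, inv_one, one_mul]
  obtain ⟨hL, hlog⟩ := log_prod_blockEntry hn hq0 hqp hpn hx hy
  refine ⟨⟨_, hL, hlog, ?_⟩, fun t => ?_⟩
  · simp only [htr, hW]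
    exact tendsto_trace_blockWord hxc (rootUnit n) hq0
  · obtain ⟨k, hk⟩ := isConj_iff.1 (hconj t)
    have hinv : IsConj (W t) (Ψ t (heckeAlpha x₀ n s))⁻¹ :=
      isConj_iff.2 ⟨k, by rw [← hk]; group⟩
    rw [htr, ← trace_conj_eq hinv]

/-- The loops `α_s` with `s ∈ [1/n, 1]` have infinite order: their traces are unbounded. -/
theorem not_isOfFinOrder_heckeAlpha {n : ℕ} (hn : 2 ≤ n) (x₀ : ConwaySphere) {s : ℚ}
    (hs : s ∈ Set.Icc (1 / (n : ℚ)) 1) : ¬ IsOfFinOrder (heckeAlpha x₀ n s) := by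
  obtain ⟨Ψ, hΨ⟩ := exists_traceFamily hn x₀
  obtain ⟨⟨L, hL, -, ht⟩, -⟩ := hΨ s hs
  obtain ⟨q, hq, hq0, -⟩ := slope_bounds hn hs
  have hqn : s.num.toNat = q := by rw [hq]; rfl
  rw [isOfFinOrder_iff_pow_eq_one]
  rintro ⟨m, hm, hpow⟩
  have hbound : ∀ t, ‖(Ψ t (heckeAlpha x₀ n s) : Matrix (Fin 2) (Fin 2) ℂ).trace‖ ≤ 2 := by
    intro t
    apply norm_trace_le_two hm
    rw [← Units.val_pow_eq_pow_val, ← map_pow, hpow, map_one, Units.val_one]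
  have h0 : Tendsto (fun t : ℝ => 2 / t ^ (2 * s.num.toNat)) atTop (𝓝 0) :=
    tendsto_const_nhds.div_atTop (tendsto_pow_atTop (by omega))
  refine hL.ne' (tendsto_nhds_unique ht (squeeze_zero' ?_ ?_ h0))
  · filter_upwards [eventually_gt_atTop 0] with t ht0
    positivity
  · filter_upwards [eventually_gt_atTop 0] with t ht0
    exact div_le_div_of_nonneg_right (hbound t) (by positivity)

theorem heckeAlpha_zero_ne_one {n : ℕ} (hn : 2 ≤ n) (x₀ : ConwaySphere) :
    heckeAlpha x₀ n 0 ≠ 1 := by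
  intro h
  have hc : (Multiplicative.ofAdd (1 : ZMod n)) ^ n = 1 := by
    rw [← ofAdd_nsmul]; simp
  obtain ⟨Ψ, h0, -⟩ := exists_heckeHom 1 (Multiplicative.ofAdd (1 : ZMod n)) hc x₀
  rw [h, map_one Ψ, isConj_one_left, inv_eq_one, ofAdd_eq_one] at h0
  have : Fact (1 < n) := ⟨hn⟩
  exact one_ne_zero h0

/-- The growth exponent of the trace recovers the numerator of the slope, and the leading
coefficient then recovers the denominator. -/
theorem eq_of_isConj_heckeAlpha {n : ℕ} (hn : 2 ≤ n) {x₀ : ConwaySphere}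
    {s s' : ℚ} (hs : s ∈ Set.Icc (1 / (n : ℚ)) 1) (hs' : s' ∈ Set.Icc (1 / (n : ℚ)) 1)
    (h : IsConj (heckeAlpha x₀ n s) (heckeAlpha x₀ n s') ∨
      IsConj (heckeAlpha x₀ n s) (heckeAlpha x₀ n s')⁻¹) : s = s' := by
  obtain ⟨Ψ, hΨ⟩ := exists_traceFamily hn x₀
  obtain ⟨⟨L, hL, hlog, ht⟩, -⟩ := hΨ s hs
  obtain ⟨⟨L', hL', hlog', ht'⟩, hinv⟩ := hΨ s' hs'
  have heq : ∀ t, ‖(Ψ t (heckeAlpha x₀ n s) : Matrix (Fin 2) (Fin 2) ℂ).trace‖ =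
      ‖(Ψ t (heckeAlpha x₀ n s') : Matrix (Fin 2) (Fin 2) ℂ).trace‖ := by
    intro t
    rcases h with h | h
    · rw [trace_conj_eq ((Ψ t).map_isConj h)]
    · rw [trace_conj_eq ((Ψ t).map_isConj h), map_inv, hinv]
  simp only [heq] at ht
  obtain ⟨q, hq, hq0, hqp, hpn, -⟩ := slope_bounds hn hs
  obtain ⟨q', hq', hq0', hqp', hpn', -⟩ := slope_bounds hn hs'
  have hqn : s.num.toNat = q := by rw [hq]; rfl
  have hqn' : s'.num.toNat = q' := by rw [hq']; rfl
  rw [hqn] at hlog ht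
  rw [hqn'] at hlog' ht'
  have h1 := tendsto_growth_unique hL' ht ht'
  have h2 := tendsto_growth_unique hL ht' ht
  obtain rfl : q = q' := by omega
  have hLL := tendsto_nhds_unique ht ht'
  rw [hLL, hlog'] at hlog
  have hmono : ∀ l, 0 < l → l + 1 ≤ n →
      Real.log (blockNorm n l) < Real.log (blockNorm n (l + 1)) := fun l hl hln =>
    Real.log_lt_log (blockNorm_pos hn hl (by omega)) (blockNorm_lt_succ hn hl hln)
  have hden : s.den = s'.den := by
    rcases lt_trichotomy s.den s'.den with hlt | he | hlt
    · exact absurd hlog (interp_lt hn hmono hq0 hqp hlt).ne'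
    · exact he
    · exact absurd hlog (interp_lt hn hmono hq0 hqp' hlt).ne
  exact Rat.ext (hq.trans hq'.symm) hden

theorem not_isPeripheral_heckeAlpha {n : ℕ} (hn : 2 ≤ n) {x₀ : ConwaySphere} {s : ℚ}
    (hs : s ∈ Set.Icc (1 / (n : ℚ)) 1) : ¬ IsPeripheral (heckeAlpha x₀ n s) := by
  rintro ⟨m, k, hk⟩
  obtain ⟨q, hq, hq0, hqp, hpn, hs0⟩ := slope_bounds hn hs
  have hcop : s.den.Coprime q := by
    have := s.reduced
    rw [hq, Int.natAbs_natCast] at this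
    exact this.symm
  have hsum1 := sum_letterSign_odd hcop
  have hsum2 := sum_letterSign_even s.den_pos hcop
  rw [letterSign_self s.den_pos] at hsum1 hsum2
  -- In a commutative quotient the relation `α_s ~ μ ^ k` becomes an equation between exponents.
  have key : ∀ (H : Type) [CommGroup H] (a c : H), c ^ n = 1 →
      (a ^ (1 + if Even s.den then (if Even q then 1 else -1) else 0 : ℤ) *
        (a⁻¹ * c) ^ (if Even s.den then 0 else (if Even q then 1 else -1) : ℤ))⁻¹ =
      (letter a (a⁻¹ * c) m.1 ^ (if Even m.2 then 1 else -1 : ℤ)) ^ k := by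
    intro H _ a c hc
    obtain ⟨Ψ, -, h1, h2⟩ := exists_heckeHom a c hc x₀
    have h3 := h1 s hs0
    rw [isConj_iff_eq, hq, lineWord_two_mul, hsum1, hsum2] at h3
    have h4 := isConj_iff_eq.1 (h2 m)
    have h5 := isConj_iff_eq.1 (Ψ.map_isConj hk)
    rw [h3, h5, map_zpow, h4]
  by_cases he : Even s.den
  -- For even denominators `a ↦ 1`, `b ↦ -1` in `ℤ` kills `α_s` but no power of a meridian.
  · have hqo : ¬ Even q := by
      intro hqe
      have := Nat.dvd_gcd he.two_dvd hqe.two_dvd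
      rw [hcop] at this
      omega
    have h := key (Multiplicative ℤ) (Multiplicative.ofAdd 1) 1 (one_pow n)
    simp only [he, hqo, if_true, if_false, letter] at h
    have hk0 : k = 0 := by
      have h' := congr_arg Multiplicative.toAdd h
      split_ifs at h' <;> simpa using h'.symm
    rw [hk0, zpow_zero, isConj_one_left] at hk
    exact not_isOfFinOrder_heckeAlpha hn x₀ hs (hk ▸ IsOfFinOrder.one)
  -- For odd denominators the map to `ℤ/n` that kills the meridian in question detects `α_s`.
  · have hg : (Multiplicative.ofAdd (1 : ZMod n)) ^ n = 1 := by
      rw [← ofAdd_nsmul]; simp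
    have hg1 : Multiplicative.ofAdd (1 : ZMod n) ≠ 1 := by
      rw [Ne, ofAdd_eq_one]
      have : Fact (1 < n) := ⟨hn⟩
      exact one_ne_zero
    by_cases hm : Even m.1
    · have h := key _ 1 (Multiplicative.ofAdd (1 : ZMod n)) hg
      simp only [he, hm, if_true, if_false, letter] at h
      apply hg1
      split_ifs at h <;> simpa using h
    · have h := key _ (Multiplicative.ofAdd (1 : ZMod n)) (Multiplicative.ofAdd (1 : ZMod n)) hg
      simp only [he, hm, if_false, letter] at h
      apply hg1
      split_ifs at h <;> simpa using h

end ConwayHecke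

end

theorem theorem2p2 (n : ℕ) (hn : 2 ≤ n) (x₀ : ConwayHecke.ConwaySphere) :
    (∀ s ∈ Set.Icc (1 / (n : ℚ)) 1 ∪ {0}, ConwayHecke.heckeAlpha x₀ n s ≠ 1) ∧
    (∀ s ∈ Set.Icc (1 / (n : ℚ)) 1, ∀ s' ∈ Set.Icc (1 / (n : ℚ)) 1, s ≠ s' →
      ¬ IsConj (ConwayHecke.heckeAlpha x₀ n s) (ConwayHecke.heckeAlpha x₀ n s') ∧
      ¬ IsConj (ConwayHecke.heckeAlpha x₀ n s) (ConwayHecke.heckeAlpha x₀ n s')⁻¹) ∧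
    (∀ s ∈ Set.Icc (1 / (n : ℚ)) 1, ¬ ConwayHecke.IsPeripheral (ConwayHecke.heckeAlpha x₀ n s)) ∧
    (∀ s ∈ Set.Icc (1 / (n : ℚ)) 1,
      ¬ ConwayHecke.IsTorsionElement (ConwayHecke.heckeAlpha x₀ n s)) := by
  refine ⟨?_, fun s hs s' hs' hne => ⟨fun h => hne ?_, fun h => hne ?_⟩,
    fun s hs => ConwayHecke.not_isPeripheral_heckeAlpha hn hs,
    fun s hs h => ConwayHecke.not_isOfFinOrder_heckeAlpha hn x₀ hs h.2⟩
  · rintro s (hs | rfl) h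
    · exact ConwayHecke.not_isOfFinOrder_heckeAlpha hn x₀ hs (h ▸ IsOfFinOrder.one)
    · exact ConwayHecke.heckeAlpha_zero_ne_one hn x₀ h
  · exact ConwayHecke.eq_of_isConj_heckeAlpha hn hs hs' (Or.inl h)
  · exact ConwayHecke.eq_of_isConj_heckeAlpha hn hs hs' (Or.inr h)
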